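/- Let $n,k\ge 1$, let $U\subseteq\mathbb C^d$ be open and invariant under complex conjugation, and let $f:U\to\mathbb C^d$ be a holomorphic vector field that is real, i.e. $f(\bar z)=\overline{f(z)}$. A one-step method on $U$ is a family of maps $M_h(z)$, jointly holomorphic in $(h,z)$ near $\{0\}\times U$, with $M_0=\mathrm{id}$. Let $\mathcal S_h$ be a one-step method on $U$ which is of order $2n$ for $\dot x=f(x)$ (that is, $\mathcal S_h(z)-\varphi^f_h(z)=\mathcal O(h^{2n+1})$, where $\varphi^f_h$ is the exact flow), time-symmetric ($\mathcal S_h\circ\mathcal S_{-h}=\mathrm{id}$) and real ($\mathcal S_h(\bar z)=\overline{\mathcal S_h(z)}$ for real $h$). All $\mathcal O$-terms for maps are meant pointwise in $z\in U$, as $h\to 0$ along real step sizes. For $j=1,\dots,k$ let $\psi^{(j)}_h=\mathcal S_{\alpha^{(j)}_1h}\circ\cdots\circ\mathcal S_{\alpha^{(j)}_{s_j}h}$ be a symmetric-conjugate and consistent composition: $\alpha^{(j)}_l\in\mathbb C$, $\overline{\alpha}{}^{(j)}_{s_j+1-l}=\alpha^{(j)}_l$ and $\sum_l\alpha^{(j)}_l=1$.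 Let $\bar\psi_h^{(j)}(z)=\overline{\psi^{(j)}_{\bar h}(\bar z)}$, $$\phi_h=\frac1{2k}\sum_{j=1}^k\big(\psi_h^{(j)}+\bar\psi_h^{(j)}\big),\qquad \mu_j=\sum_l\big(\alpha_l^{(j)}\big)^{2n+1}.$$ To a one-step method $M_h$ associate the formal power series in $h$ of linear operators on the holomorphic functions on $U$ that maps $g$ to the Taylor expansion at $h=0$ of $g(M_h(z))$. Let $\Psi^{(j)}$, $\bar\Psi^{(j)}$ and $e^{Y(h)}$ be the series of $\psi^{(j)}$, $\bar\psi^{(j)}$ and $\mathcal S$, let $F=\sum_i f_i\,\partial/\partial x_i$, let $\Phi=\frac1{2k}\sum_j(\Psi^{(j)}+\bar\Psi^{(j)})$, define $W_j(h)$ by $e^{W_j}=e^{-\frac h2F}\,\Psi^{(j)}\,e^{-\frac h2F}$, and let $\overline W_j$ be the complex conjugate series (the conjugate of an operator $D$ being $g\mapsto\overline{D[\bar g]}$, with $\bar g(z)=\overline{g(\bar z)}$). Let $Y_{2n+1}$ be the coefficient of $h^{2n+1}$ in $Y(h)$. Then: 1. For every linear function $g$ on $\mathbb C^d$, $\Phi(h)[g](z)$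 is the Taylor expansion of $g(\phi_h(z))$. For every $j$, $\Psi^{(j)}=e^{\frac h2F}e^{W_j}e^{\frac h2F}$ and $\bar\Psi^{(j)}=e^{\frac h2F}e^{\overline W_j}e^{\frac h2F}$, where $W_j=h^{2n+1}\mu_jY_{2n+1}+\mathcal O(h^{2n+2})$, and $W_j+\overline W_j$ contains only odd powers of $h$. 2. For every $j$, $\ \tfrac12\big(\Psi^{(j)}+\bar\Psi^{(j)}\big)=e^{\frac h2F}\,e^{\frac12(W_j+\overline W_j)}\,e^{\frac h2F}+\mathcal O(h^{4n+4})$. 3. $\displaystyle\frac1{2k}\sum_{j}\big(e^{W_j}+e^{\overline W_j}\big)=\exp\Big(\frac1{2k}\sum_{j}(W_j+\overline W_j)\Big)+h^{4n+2}\,\frac1{2k}\Big(\sum_j\mu_j^2-\frac1k\Big(\sum_j\mu_j\Big)^2\Big)Y_{2n+1}^2+\mathcal O(h^{4n+4}),$ and $$\Phi(h)=e^{\frac h2F}\exp\Big(\frac1{2k}\sum_{j=1}^k\big(W_j(h)+\overline W_j(h)\big)\Big)e^{\frac h2F}+\mathcal O(h^{4n+2}).$$ 4. Each term $R_h^{(j)}=\frac12(\psi_h^{(j)}+\bar\psi_h^{(j)})$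 of $\phi_h$ is pseudo-symmetric of order $4n+3$, i.e. $R^{(j)}_h\circ R^{(j)}_{-h}=\mathrm{id}+\mathcal O(h^{4n+4})$. The combination $\phi_h$ is pseudo-symmetric of order $4n+1$, and it is pseudo-symmetric of order $4n+3$ whenever $\mu_1=\dots=\mu_k$. 5. Suppose moreover that, for an invertible skew-symmetric real matrix $J$, the field is Hamiltonian ($Jf=\nabla H$ for a holomorphic $H$ on $U$) and $\mathcal S_h$ is symplectic ($(\mathcal S_h')^TJ\,\mathcal S_h'=J$ for small real $h$). Then each $R_h^{(j)}$ is pseudo-symplectic of order $4n+3$, i.e. $(R_h^{(j)\prime})^TJ\,R_h^{(j)\prime}=J+\mathcal O(h^{4n+4})$; $\phi_h$ is pseudo-symplectic of order $4n+1$, and of order $4n+3$ whenever $\mu_1=\dots=\mu_k$. -/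

import Mathlib

open Filter Topology
open scoped PowerSeries Matrix

noncomputable section

namespace OneStep

/-- If `g` is holomorphic at `star x`, then `z ↦ star (g (star z))` is holomorphic at `x`. -/
theorem analyticAt_star_star {E F : Type*}
    [NormedAddCommGroup E] [NormedSpace ℂ E] [StarAddMonoid E] [StarModule ℂ E]
    [NormedAddCommGroup F] [NormedSpace ℂ F] [StarAddMonoid F] [StarModule ℂ F]
    (hE : ∀ x : E, ‖star x‖ = ‖x‖) (hF : ∀ y : F, ‖star y‖ = ‖y‖)
    {g : E → F} {x : E} (hg : AnalyticAt ℂ g (star x)) :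
    AnalyticAt ℂ (fun z => star (g (star z))) x := by
  obtain ⟨p, r, hp⟩ := hg
  have hcF : Continuous (star : F → F) :=
    AddMonoidHomClass.continuous_of_bound (starAddEquiv (R := F)) 1 (by simp [hF])
  have bound : ∀ (n : ℕ) (v : Fin n → E),
      ‖star (p n fun i => star (v i))‖ ≤ ‖p n‖ * ∏ i, ‖v i‖ := by
    intro n v
    rw [hF]
    refine ((p n).le_opNorm _).trans_eq ?_
    simp [hE]
  have upd : ∀ (n : ℕ) [DecidableEq (Fin n)] (v : Fin n → E) (i : Fin n) (a : E),
      (fun j => star (Function.update v i a j))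
        = Function.update (fun j => star (v j)) i (star a) := by
    intro n _ v i a
    funext j
    by_cases h : j = i
    · subst h; simp
    · simp [Function.update_of_ne h]
  let m : ∀ n : ℕ, MultilinearMap ℂ (fun _ : Fin n => E) F := fun n =>
    { toFun := fun v => star (p n fun i => star (v i))
      map_update_add' := by
        intro _ v i a b
        simp only [upd, star_add, ContinuousMultilinearMap.map_update_add]
      map_update_smul' := by
        intro _ v i c a
        simp only [upd, star_smul, ContinuousMultilinearMap.map_update_smul, star_star] }
  let q : FormalMultilinearSeries ℂ E F := fun n => (m n).mkContinuous ‖p n‖ (bound n)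
  have hq : ∀ n, ‖q n‖ ≤ ‖p n‖ := fun n =>
    MultilinearMap.mkContinuous_norm_le _ (norm_nonneg _) _
  refine ⟨q, r, ⟨hp.r_le.trans ?_, hp.r_pos, ?_⟩⟩
  · refine ENNReal.le_of_forall_nnreal_lt fun s hs => ?_
    obtain ⟨C, _, hC⟩ := p.norm_mul_pow_le_of_lt_radius hs
    exact q.le_radius_of_bound C fun n =>
      (mul_le_mul_of_nonneg_right (hq n) (by positivity)).trans (hC n)
  · intro y hy
    have hy' : star y ∈ Metric.eball (0 : E) r := by
      rw [Metric.mem_eball, edist_zero_right, ← ofReal_norm] at hy ⊢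
      rwa [hE]
    have := (hp.hasSum hy').map (starAddEquiv (R := F)) hcF
    simpa [Function.comp_def, q, m] using this

theorem norm_star_pi {d : ℕ} (z : Fin d → ℂ) : ‖star z‖ = ‖z‖ := by
  simp [Pi.norm_def]

theorem norm_star_prod {d : ℕ} (p : ℂ × (Fin d → ℂ)) : ‖star p‖ = ‖p‖ := by
  simp [Prod.norm_def]

/-- Time derivatives at `0` of a jointly holomorphic function depend holomorphically on the
space variable. -/
theorem analyticAt_iteratedDeriv {d : ℕ} (m : ℕ) (G : ℂ × (Fin d → ℂ) → ℂ) (z : Fin d → ℂ)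
    (hG : AnalyticAt ℂ G (0, z)) :
    AnalyticAt ℂ (fun w => iteratedDeriv m (fun h : ℂ => G (h, w)) 0) z := by
  induction m generalizing G with
  | zero =>
    have : AnalyticAt ℂ (fun w : Fin d → ℂ => ((0 : ℂ), w)) z := by fun_prop
    simpa using AnalyticAt.fun_comp (f := fun w : Fin d → ℂ => ((0 : ℂ), w)) hG this
  | succ m ih =>
    have h1 : AnalyticAt ℂ (fun p => fderiv ℂ G p ((1 : ℂ), (0 : Fin d → ℂ))) (0, z) :=
      
      ((ContinuousLinearMap.apply ℂ ℂ ((1 : ℂ), (0 : Fin d → ℂ))).analyticAt _).fun_comp hG.fderiv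
    refine (ih _ h1).congr ?_
    have hc : Tendsto (fun w : Fin d → ℂ => ((0 : ℂ), w)) (𝓝 z) (𝓝 ((0 : ℂ), z)) :=
      Continuous.tendsto (by fun_prop) z
    filter_upwards [hc.eventually hG.eventually_analyticAt] with w hw
    rw [iteratedDeriv_succ']
    refine (Filter.EventuallyEq.iteratedDeriv_eq m ?_).symm
    have hc' : Tendsto (fun h : ℂ => (h, w)) (𝓝 0) (𝓝 ((0 : ℂ), w)) :=
      Continuous.tendsto (by fun_prop) 0
    filter_upwards [hc'.eventually hw.eventually_analyticAt] with h hh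
    have hd : HasDerivAt (fun h : ℂ => (h, w)) ((1 : ℂ), (0 : Fin d → ℂ)) h :=
      (hasDerivAt_id h).prodMk (hasDerivAt_const h w)
    exact (hh.differentiableAt.hasFDerivAt.comp_hasDerivAt h hd).deriv

/-! ### Formal power series of operators -/

/-- The exponential `∑ Wʲ / j!` of a power series with zero constant coefficient, over a possibly
noncommutative `ℂ`-algebra. (Terms with `j > m` do not contribute to the coefficient of `hᵐ`.) -/
def fexp {A : Type*} [Ring A] [Algebra ℂ A] (W : A⟦X⟧) : A⟦X⟧ :=
  PowerSeries.mk fun m =>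
    ∑ j ∈ Finset.range (m + 1), ((j.factorial : ℂ)⁻¹) • PowerSeries.coeff m (W ^ j)

/-- The logarithm `∑_{j ≥ 1} (-1)^(j+1) (P - 1)ʲ / j` of a power series with constant
coefficient `1`. -/
def flog {A : Type*} [Ring A] [Algebra ℂ A] (P : A⟦X⟧) : A⟦X⟧ :=
  PowerSeries.mk fun m =>
    ∑ j ∈ Finset.Icc 1 m, ((-1 : ℂ) ^ (j + 1) / (j : ℂ)) • PowerSeries.coeff m ((P - 1) ^ j)

/-- Multiplication of all coefficients of a power series by a complex number. -/
def cmul {A : Type*} [Ring A] [Algebra ℂ A] (c : ℂ) (P : A⟦X⟧) : A⟦X⟧ :=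
  PowerSeries.mk fun m => c • PowerSeries.coeff m P

/-- `P = Q + O(h ^ m)` as formal power series in `h`. -/
def EqUpTo {A : Type*} [Ring A] (m : ℕ) (P Q : A⟦X⟧) : Prop :=
  ∀ i < m, PowerSeries.coeff i P = PowerSeries.coeff i Q

/-! ### Holomorphic functions on a domain, and operators on them -/

/-- The space of holomorphic functions on the open set `U` of `ℂᵈ`, each represented by its
extension by zero outside `U`. -/
def HolFun {d : ℕ} (U : TopologicalSpace.Opens (Fin d → ℂ)) :
    Submodule ℂ ((Fin d → ℂ) → ℂ) where
  carrier := {g | AnalyticOnNhd ℂ g U ∧ ∀ z ∉ U, g z = 0}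
  add_mem' := by
    rintro a b ⟨ha, ha'⟩ ⟨hb, hb'⟩
    exact ⟨ha.add hb, fun z hz => by simp [ha' z hz, hb' z hz]⟩
  zero_mem' := ⟨fun _ _ => analyticAt_const, fun _ _ => rfl⟩
  smul_mem' := by
    rintro c a ⟨ha, ha'⟩
    exact ⟨fun z hz => analyticAt_const.smul (ha z hz), fun z hz => by simp [ha' z hz]⟩

/-- Linear operators on the holomorphic functions on `U`. -/
abbrev Op {d : ℕ} (U : TopologicalSpace.Opens (Fin d → ℂ)) : Type := Module.End ℂ (HolFun U)

theorem indicator_mem_holFun {d : ℕ} {U : TopologicalSpace.Opens (Fin d → ℂ)}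
    {g : (Fin d → ℂ) → ℂ} (hg : AnalyticOnNhd ℂ g U) :
    (U : Set (Fin d → ℂ)).indicator g ∈ HolFun U := by
  refine ⟨fun z hz => (hg z hz).congr ?_, fun z hz => Set.indicator_of_notMem hz g⟩
  filter_upwards [U.isOpen.mem_nhds hz] with w hw
  exact (Set.indicator_of_mem hw g).symm

/-- The Lie derivative `F = ∑ i, fᵢ ∂/∂xᵢ` of a holomorphic vector field `f` on `U`. -/
def lieDeriv {d : ℕ} {U : TopologicalSpace.Opens (Fin d → ℂ)} (f : (Fin d → ℂ) → (Fin d → ℂ))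
    (hf : AnalyticOnNhd ℂ f U) : Op U where
  toFun g := ⟨(U : Set (Fin d → ℂ)).indicator fun z => fderiv ℂ (g : (Fin d → ℂ) → ℂ) z (f z),
    indicator_mem_holFun fun z hz => by
      have h1 : AnalyticAt ℂ (fun w => (fderiv ℂ (g : (Fin d → ℂ) → ℂ) w, f w)) z :=
        (g.2.1 z hz).fderiv.prod (hf z hz)
      exact (ContinuousLinearMap.analyticAt_bilinear
        (ContinuousLinearMap.id ℂ ((Fin d → ℂ) →L[ℂ] ℂ)) _).fun_comp h1⟩
  map_add' a b := by
    ext z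
    by_cases hz : z ∈ (U : Set (Fin d → ℂ))
    · simp [hz, fderiv_add (a.2.1 z hz).differentiableAt (b.2.1 z hz).differentiableAt]
    · simp [hz]
  map_smul' c a := by
    ext z
    by_cases hz : z ∈ (U : Set (Fin d → ℂ))
    · simp [hz, fderiv_const_smul (a.2.1 z hz).differentiableAt c]
    · simp [hz]

/-- Complex conjugation `ḡ(z) = conj (g (conj z))` of functions on a conjugation-invariant `U`;
on real points this is the pointwise conjugate. -/
def conjFun {d : ℕ} {U : TopologicalSpace.Opens (Fin d → ℂ)} (hU : ∀ z ∈ U, star z ∈ U)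
    (g : HolFun U) : HolFun U :=
  ⟨fun z => star ((g : (Fin d → ℂ) → ℂ) (star z)),
    fun z hz => analyticAt_star_star norm_star_pi norm_star (g.2.1 _ (hU z hz)),
    fun z hz => by
      have h0 := g.2.2 (star z) fun h => hz (by simpa using hU _ h)
      simp [h0]⟩

/-- The complex conjugate `D̄[g] = conj (D[conj g])` of an operator. -/
def conjOp {d : ℕ} {U : TopologicalSpace.Opens (Fin d → ℂ)} (hU : ∀ z ∈ U, star z ∈ U)
    (D : Op U) : Op U where
  toFun g := conjFun hU (D (conjFun hU g))
  map_add' a b := by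
    have h : conjFun hU (a + b) = conjFun hU a + conjFun hU b := by
      ext z; simp [conjFun]
    rw [h, map_add]
    ext z; simp [conjFun]
  map_smul' c a := by
    have h : conjFun hU (c • a) = star c • conjFun hU a := by
      ext z; simp [conjFun]
    rw [h, map_smul]
    ext z; simp [conjFun]

/-- The coefficientwise complex conjugate of a series of operators (`h` is a real variable). -/
def conjSeries {d : ℕ} {U : TopologicalSpace.Opens (Fin d → ℂ)} (hU : ∀ z ∈ U, star z ∈ U)
    (P : (Op U)⟦X⟧) : (Op U)⟦X⟧ :=
  PowerSeries.mk fun m => conjOp hU (PowerSeries.coeff m P)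

/-! ### One-step methods -/

/-- A one-step method on `U`: a family of maps `z ↦ toFun h z` depending on a complex step size
`h`, jointly holomorphic in `(h, z)` near `h = 0`, and equal to the identity for `h = 0`. -/
structure Integrator {d : ℕ} (U : TopologicalSpace.Opens (Fin d → ℂ)) where
  toFun : ℂ → (Fin d → ℂ) → (Fin d → ℂ)
  analytic : ∀ z ∈ U, AnalyticAt ℂ (fun p : ℂ × (Fin d → ℂ) => toFun p.1 p.2) (0, z)
  map_zero : ∀ z ∈ U, toFun 0 z = z

namespace Integrator

variable {d : ℕ} {U : TopologicalSpace.Opens (Fin d → ℂ)}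

/-- The identity method. -/
def one (U : TopologicalSpace.Opens (Fin d → ℂ)) : Integrator U where
  toFun _ z := z
  analytic _ _ := analyticAt_snd
  map_zero _ _ := rfl

/-- The method with rescaled step size, `h ↦ S_{a h}`. -/
def scale (S : Integrator U) (a : ℂ) : Integrator U where
  toFun h z := S.toFun (a * h) z
  analytic z hz := by
    have h1 : AnalyticAt ℂ (fun p : ℂ × (Fin d → ℂ) => (a * p.1, p.2)) (0, z) :=
      (analyticAt_const.mul analyticAt_fst).prod analyticAt_snd
    exact AnalyticAt.fun_comp_of_eq (S.analytic z hz) h1 (by simp)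
  map_zero z hz := by simpa using S.map_zero z hz

/-- The composition `h ↦ S_h ∘ T_h`. -/
def comp (S T : Integrator U) : Integrator U where
  toFun h z := S.toFun h (T.toFun h z)
  analytic z hz := by
    have h1 : AnalyticAt ℂ (fun p : ℂ × (Fin d → ℂ) => (p.1, T.toFun p.1 p.2)) (0, z) :=
      analyticAt_fst.prod (T.analytic z hz)
    exact AnalyticAt.fun_comp_of_eq (S.analytic z hz) h1 (by simp [T.map_zero z hz])
  map_zero z hz := by rw [T.map_zero z hz, S.map_zero z hz]

/-- `S_{a₁ h} ∘ S_{a₂ h} ∘ ⋯ ∘ S_{aₛ h}` for a list `[a₁, …, aₛ]` of coefficients. -/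
def compList (S : Integrator U) : List ℂ → Integrator U
  | [] => one U
  | a :: l => (S.scale a).comp (S.compList l)

/-- The composition method `ψ_h = S_{α₁ h} ∘ S_{α₂ h} ∘ ⋯ ∘ S_{αₛ h}`. -/
def composition (S : Integrator U) {s : ℕ} (α : Fin s → ℂ) : Integrator U :=
  S.compList (List.ofFn α)

/-- The complex conjugate method: `ψ̄_h(z) = conj (ψ_h (z))` for real `h` and `z`, extended
holomorphically to complex `h` and `z`. -/
def conj (hU : ∀ z ∈ U, star z ∈ U) (M : Integrator U) : Integrator U where
  toFun h z := star (M.toFun (star h) (star z))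
  analytic z hz := by
    have h1 := M.analytic _ (hU z hz)
    have h2 : ((0 : ℂ), star z) = star ((0 : ℂ), z) := by ext <;> simp
    rw [h2] at h1
    exact analyticAt_star_star norm_star_prod norm_star_pi h1
  map_zero z hz := by
    rw [star_zero, M.map_zero _ (hU z hz), star_star]

/-- The `m`-th coefficient of the series of operators of a method: `g` is mapped to the `m`-th
Taylor coefficient in `h`, at `h = 0`, of `g (M_h (z))`. -/
def opCoeff (M : Integrator U) (m : ℕ) : Op U :=
  have key : ∀ (g : HolFun U) (z : Fin d → ℂ), z ∈ U →
      AnalyticAt ℂ (fun p : ℂ × (Fin d → ℂ) => (g : (Fin d → ℂ) → ℂ) (M.toFun p.1 p.2)) (0, z) :=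
    fun g z hz => AnalyticAt.fun_comp_of_eq (g.2.1 z hz) (M.analytic z hz) (M.map_zero z hz)
  have key' : ∀ (g : HolFun U) (z : Fin d → ℂ), z ∈ U →
      ContDiffAt ℂ m (fun h : ℂ => (g : (Fin d → ℂ) → ℂ) (M.toFun h z)) 0 := fun g z hz =>
    (AnalyticAt.fun_comp (f := fun h : ℂ => (h, z)) (key g z hz)
      (by fun_prop)).contDiffAt
  { toFun := fun g => ⟨(U : Set (Fin d → ℂ)).indicator fun z =>
        ((m.factorial : ℂ)⁻¹) *
          iteratedDeriv m (fun h : ℂ => (g : (Fin d → ℂ) → ℂ) (M.toFun h z)) 0,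
      indicator_mem_holFun fun z hz =>
        analyticAt_const.mul (analyticAt_iteratedDeriv m _ z (key g z hz))⟩
    map_add' := fun a b => by
      ext z
      by_cases hz : z ∈ (U : Set (Fin d → ℂ))
      · have := iteratedDeriv_fun_add (key' a z hz) (key' b z hz)
        simp [hz, this, mul_add]
      · simp [hz]
    map_smul' := fun c a => by
      ext z
      by_cases hz : z ∈ (U : Set (Fin d → ℂ))
      · simp [hz, mul_left_comm]
      · simp [hz] }

/-- The series of operators `Ψ(h)` of a method, characterised by `g (M_h (z)) = Ψ(h)[g](z)`. -/
def opSeries (M : Integrator U) : (Op U)⟦X⟧ := PowerSeries.mk M.opCoeff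

end Integrator

/-! ### Properties of methods -/

/-- `M_h(z) = φ_h(z) + O(h^(r+1))`, with `φ_h` the flow of `f`, for all `z ∈ U`. -/
def HasOrder {d : ℕ} (U : TopologicalSpace.Opens (Fin d → ℂ)) (f : (Fin d → ℂ) → (Fin d → ℂ))
    (M : ℂ → (Fin d → ℂ) → (Fin d → ℂ)) (r : ℕ) : Prop :=
  ∀ z ∈ U, ∀ x : ℝ → (Fin d → ℂ), x 0 = z →
    (∀ᶠ t in 𝓝 (0 : ℝ), HasDerivAt x (f (x t)) t) →
    (fun h : ℝ => M h z - x h) =O[𝓝 0] fun h : ℝ => h ^ (r + 1)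

/-- `M_h ∘ M_{-h} = id`. -/
def IsTimeSymmetric {d : ℕ} (U : TopologicalSpace.Opens (Fin d → ℂ))
    (M : ℂ → (Fin d → ℂ) → (Fin d → ℂ)) : Prop :=
  ∀ z ∈ U, ∀ᶠ h : ℝ in 𝓝 0, M h (M (-h) z) = z

/-- `M` is real: for real step sizes it commutes with complex conjugation (in particular, it maps
real points to real points). -/
def IsRealMethod {d : ℕ} (U : TopologicalSpace.Opens (Fin d → ℂ))
    (M : ℂ → (Fin d → ℂ) → (Fin d → ℂ)) : Prop :=
  ∀ z ∈ U, ∀ᶠ h : ℝ in 𝓝 0, M h (star z) = star (M h z)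

/-- Pseudo-symmetry of order `q`: `M_h ∘ M_{-h} = id + O(h^(q+1))`. -/
def IsPseudoSymmetric {d : ℕ} (U : TopologicalSpace.Opens (Fin d → ℂ))
    (M : ℂ → (Fin d → ℂ) → (Fin d → ℂ)) (q : ℕ) : Prop :=
  ∀ z ∈ U, (fun h : ℝ => M h (M (-h) z) - z) =O[𝓝 0] fun h : ℝ => h ^ (q + 1)

/-- The Jacobian matrix of `M_h` at `z`. -/
def jacobian {d : ℕ} (M : ℂ → (Fin d → ℂ) → (Fin d → ℂ)) (h : ℂ) (z : Fin d → ℂ) :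
    Matrix (Fin d) (Fin d) ℂ :=
  LinearMap.toMatrix' (fderiv ℂ (M h) z : (Fin d → ℂ) →ₗ[ℂ] (Fin d → ℂ))

/-- `f` is a Hamiltonian vector field on `U` for the symplectic form with matrix `J`:
`J f = ∇H` for some function `H`. -/
def IsHamiltonian {d : ℕ} (U : TopologicalSpace.Opens (Fin d → ℂ)) (J : Matrix (Fin d) (Fin d) ℝ)
    (f : (Fin d → ℂ) → (Fin d → ℂ)) : Prop :=
  ∃ H : (Fin d → ℂ) → ℂ, AnalyticOnNhd ℂ H U ∧
    ∀ z ∈ U, ∀ i, (J.map (fun x : ℝ => (x : ℂ)) *ᵥ f z) i = fderiv ℂ H z (Pi.single i 1)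

/-- `(M_h')ᵀ J M_h' = J`. -/
def IsSymplectic {d : ℕ} (U : TopologicalSpace.Opens (Fin d → ℂ)) (J : Matrix (Fin d) (Fin d) ℝ)
    (M : ℂ → (Fin d → ℂ) → (Fin d → ℂ)) : Prop :=
  ∀ z ∈ U, ∀ᶠ h : ℝ in 𝓝 0,
    (jacobian M h z)ᵀ * J.map (fun x : ℝ => (x : ℂ)) * jacobian M h z
      = J.map (fun x : ℝ => (x : ℂ))

/-- Pseudo-symplecticity of order `q`: `(M_h')ᵀ J M_h' = J + O(h^(q+1))`. -/
def IsPseudoSymplectic {d : ℕ} (U : TopologicalSpace.Opens (Fin d → ℂ))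
    (J : Matrix (Fin d) (Fin d) ℝ) (M : ℂ → (Fin d → ℂ) → (Fin d → ℂ)) (q : ℕ) : Prop :=
  ∀ z ∈ U, ∀ i j, (fun h : ℝ =>
    ((jacobian M h z)ᵀ * J.map (fun x : ℝ => (x : ℂ)) * jacobian M h z
      - J.map (fun x : ℝ => (x : ℂ))) i j) =O[𝓝 0] fun h : ℝ => h ^ (q + 1)

/-- The real part `½ (ψ_h + ψ̄_h)` of a method. -/
def reMethod {d : ℕ} {U : TopologicalSpace.Opens (Fin d → ℂ)} (hU : ∀ z ∈ U, star z ∈ U)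
    (ψ : Integrator U) : ℂ → (Fin d → ℂ) → (Fin d → ℂ) :=
  fun h z => (1 / 2 : ℂ) • (ψ.toFun h z + (ψ.conj hU).toFun h z)

/-- The linear combination `φ_h = (1 / 2k) ∑ⱼ (ψ_h⁽ʲ⁾ + ψ̄_h⁽ʲ⁾)`. -/
def linComb {d k : ℕ} {U : TopologicalSpace.Opens (Fin d → ℂ)} (hU : ∀ z ∈ U, star z ∈ U)
    (ψ : Fin k → Integrator U) : ℂ → (Fin d → ℂ) → (Fin d → ℂ) :=
  fun h z => (1 / (2 * k) : ℂ) • ∑ j, ((ψ j).toFun h z + ((ψ j).conj hU).toFun h z)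

/-- The series `Φ(h) = (1 / 2k) ∑ⱼ (Ψ⁽ʲ⁾(h) + Ψ̄⁽ʲ⁾(h))` of operators of `linComb hU ψ`. -/
def linCombSeries {d k : ℕ} {U : TopologicalSpace.Opens (Fin d → ℂ)}
    (hU : ∀ z ∈ U, star z ∈ U) (ψ : Fin k → Integrator U) : (Op U)⟦X⟧ :=
  cmul (1 / (2 * k) : ℂ) (∑ j, ((ψ j).opSeries + ((ψ j).conj hU).opSeries))

/-- The series `exp (c h D)` for an operator `D`. -/
def expStep {d : ℕ} {U : TopologicalSpace.Opens (Fin d → ℂ)} (c : ℂ) (D : Op U) : (Op U)⟦X⟧ :=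
  fexp (PowerSeries.monomial 1 (c • D))

/-- The series `W(h)` with `Ψ(h) = exp (h F / 2) exp (W(h)) exp (h F / 2)`. -/
def centralExponent {d : ℕ} {U : TopologicalSpace.Opens (Fin d → ℂ)} (F : Op U)
    (ψ : Integrator U) : (Op U)⟦X⟧ :=
  flog (expStep (-1 / 2) F * ψ.opSeries * expStep (-1 / 2) F)

end OneStep

end

open OneStep

set_option linter.unusedSectionVars false

noncomputable section

namespace OneStep

/-! ### Substitution of a series with noncommuting coefficients into a scalar series -/

section FormalSeries

variable {A : Type*} [Ring A] [Algebra ℂ A]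

/-! Put N = 2n+1. Passing to operator series turns composition of maps into multiplication in
reversed order (`Integrator.opSeries_comp`), and the order hypothesis says that the series P of S
agrees with exp(hF) below h^N (`opSeries_eqUpTo_expStep`). Items 1 to 3 then become statements about
A⟦X⟧ for any ℂ-algebra A with an antilinear ring endomorphism σ (`symmetricConjugate_expansions`).

Time symmetry makes the composition with reversed coefficients inverse to the original one at -h;
for symmetric-conjugate coefficients, reversal is conjugation. Hence W̄(h) = -W(-h)
(`map_centralLog`), so W + W̄ is odd. Since N is odd, W and W̄ share their leading term μ Y_N h^N
(`centralLog_leading`). To second order, ½(e^W + e^W̄) - e^{(W+W̄)/2} is (W - W̄)²/8, which is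
O(h^{2N+2}). Averaging over j leaves, at h^{2N}, half the variance of the μ_j times Y_N²
(`mean_fexp_add_fexp_eqUpTo`).

Items 4 and 5 are proved on the maps themselves, since Φ is only known to represent φ on linear
functions. There φ is the mean of 2k maps M_i that agree up to O(h^m) and are adjoint in pairs. The
deviations M_i - φ are O(h^m) and sum to zero, so first-order effects cancel and the defects are
O(h^{2m}) (`isPseudoSymmetric_weightedSum`, `isPseudoSymplectic_weightedSum`). Always m = N is
admissible, and m = N+1 when the μ_j coincide. The latter covers a single conjugate pair, because
reversing the coefficients does not change μ. -/

theorem coeff_pow_eq_zero {V : A⟦X⟧} (hV : PowerSeries.constantCoeff V = 0) {m j : ℕ}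
    (h : m < j) : PowerSeries.coeff m (V ^ j) = 0 :=
  PowerSeries.coeff_of_lt_order _ ((Nat.cast_lt.2 h).trans_le
    (PowerSeries.le_order_pow_of_constantCoeff_eq_zero j hV))

/-- The substitution `f(V) = ∑ fⱼ Vʲ` of a series `V` with zero constant coefficient. -/
def evalSeries (V : A⟦X⟧) (f : ℂ⟦X⟧) : A⟦X⟧ :=
  PowerSeries.mk fun m =>
    ∑ j ∈ Finset.range (m + 1), PowerSeries.coeff j f • PowerSeries.coeff m (V ^ j)

/-- Powers beyond the m-th contribute nothing at h^m, so the cut-off may be enlarged at will. -/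
theorem coeff_evalSeries {V : A⟦X⟧} (hV : PowerSeries.constantCoeff V = 0) (f : ℂ⟦X⟧) {m N : ℕ}
    (h : m < N) : PowerSeries.coeff m (evalSeries V f)
      = ∑ j ∈ Finset.range N, PowerSeries.coeff j f • PowerSeries.coeff m (V ^ j) := by
  rw [evalSeries, PowerSeries.coeff_mk]
  refine Finset.sum_subset (Finset.range_subset_range.2 h) fun j _ hj => ?_
  rw [coeff_pow_eq_zero hV (by simpa using hj), smul_zero]

theorem evalSeries_congr (V : A⟦X⟧) {f g : ℂ⟦X⟧} {m : ℕ}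
    (h : ∀ j ≤ m, PowerSeries.coeff j f = PowerSeries.coeff j g) :
    PowerSeries.coeff m (evalSeries V f) = PowerSeries.coeff m (evalSeries V g) := by
  simp only [evalSeries, PowerSeries.coeff_mk]
  exact Finset.sum_congr rfl fun j hj => by rw [h j (Nat.lt_succ_iff.1 (Finset.mem_range.1 hj))]

theorem evalSeries_coe {V : A⟦X⟧} (hV : PowerSeries.constantCoeff V = 0) (p : Polynomial ℂ) :
    evalSeries V (p : ℂ⟦X⟧) = Polynomial.aeval V p := by
  ext m
  rw [coeff_evalSeries hV _ (lt_of_lt_of_le (Nat.lt_succ_self m) (le_max_left _ (p.natDegree + 1))),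
    Polynomial.aeval_eq_sum_range' (lt_of_lt_of_le (Nat.lt_succ_self _)
      (le_max_right (m + 1) (p.natDegree + 1))), map_sum]
  simp

theorem coeff_evalSeries_trunc (V : A⟦X⟧) (f : ℂ⟦X⟧) {m N : ℕ} (h : m < N) :
    PowerSeries.coeff m (evalSeries V f)
      = PowerSeries.coeff m (evalSeries V (PowerSeries.trunc N f : ℂ⟦X⟧)) :=
  evalSeries_congr V fun j hj => by
    rw [Polynomial.coeff_coe, PowerSeries.coeff_trunc, if_pos (lt_of_le_of_lt hj h)]

/-- Only powers of the single series V occur, so noncommutativity of A is harmless. Each coefficient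
sees finitely many terms of f and g, which may thus be replaced by polynomials, where
`Polynomial.aeval` is multiplicative. -/
theorem evalSeries_mul {V : A⟦X⟧} (hV : PowerSeries.constantCoeff V = 0) (f g : ℂ⟦X⟧) :
    evalSeries V (f * g) = evalSeries V f * evalSeries V g := by
  ext m
  have h1 : PowerSeries.coeff m (evalSeries V (f * g))
      = PowerSeries.coeff m (evalSeries V
        ((PowerSeries.trunc (m + 1) f * PowerSeries.trunc (m + 1) g : Polynomial ℂ) : ℂ⟦X⟧)) := by
    refine evalSeries_congr V fun j hj => ?_
    rw [Polynomial.coe_mul, PowerSeries.coeff_mul, PowerSeries.coeff_mul]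
    refine Finset.sum_congr rfl fun x hx => ?_
    have := Finset.HasAntidiagonal.mem_antidiagonal.1 hx
    rw [Polynomial.coeff_coe, PowerSeries.coeff_trunc, if_pos (by omega), Polynomial.coeff_coe,
      PowerSeries.coeff_trunc, if_pos (by omega)]
  rw [h1, evalSeries_coe hV, map_mul, ← evalSeries_coe hV, ← evalSeries_coe hV,
    PowerSeries.coeff_mul, PowerSeries.coeff_mul]
  refine Finset.sum_congr rfl fun x hx => ?_
  have := Finset.HasAntidiagonal.mem_antidiagonal.1 hx
  rw [← coeff_evalSeries_trunc V f (by omega), ← coeff_evalSeries_trunc V g (by omega)]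

/-- Substitution as a homomorphism of algebras. -/
def evalHom (V : A⟦X⟧) (hV : PowerSeries.constantCoeff V = 0) : ℂ⟦X⟧ →ₐ[ℂ] A⟦X⟧ :=
  AlgHom.ofLinearMap
    { toFun := evalSeries V
      map_add' := fun f g => by ext m; simp [evalSeries, add_smul, Finset.sum_add_distrib]
      map_smul' := fun c f => by ext m; simp [evalSeries, mul_smul, Finset.smul_sum] }
    (by simpa using evalSeries_coe hV 1)
    (evalSeries_mul hV)

theorem evalSeries_X {V : A⟦X⟧} (hV : PowerSeries.constantCoeff V = 0) :
    evalSeries V PowerSeries.X = V := by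
  simpa using evalSeries_coe hV Polynomial.X

theorem constantCoeff_evalSeries (V : A⟦X⟧) (f : ℂ⟦X⟧) :
    PowerSeries.constantCoeff (evalSeries V f)
      = algebraMap ℂ A (PowerSeries.constantCoeff f) := by
  rw [← PowerSeries.coeff_zero_eq_constantCoeff_apply, evalSeries, PowerSeries.coeff_mk]
  simp [Algebra.algebraMap_eq_smul_one]

/-- For polynomial f this is the fact that `evalHom V hV` commutes with polynomial evaluation;
truncation gives the general case. It transports scalar identities such as exp(log(1+X)) = 1+X to
A⟦X⟧. -/
theorem evalSeries_evalSeries {V : A⟦X⟧} (hV : PowerSeries.constantCoeff V = 0) (f : ℂ⟦X⟧)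
    {g : ℂ⟦X⟧} (hg : PowerSeries.constantCoeff g = 0) :
    evalSeries (evalSeries V g) f = evalSeries V (evalSeries g f) := by
  have hVg : PowerSeries.constantCoeff (evalSeries V g) = 0 := by
    rw [constantCoeff_evalSeries, hg, map_zero]
  have hp : ∀ p : Polynomial ℂ,
      evalSeries (evalSeries V g) p = evalSeries V (evalSeries g (p : ℂ⟦X⟧)) := fun p => by
    rw [evalSeries_coe hVg, evalSeries_coe hg]
    exact Polynomial.aeval_algHom_apply (evalHom V hV) g p
  ext m
  rw [coeff_evalSeries_trunc _ f (Nat.lt_succ_self m), hp]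
  exact evalSeries_congr V fun j hj => (coeff_evalSeries_trunc g f (Nat.lt_succ_of_le hj)).symm

theorem evalSeries_eq_subst {g : ℂ⟦X⟧} (hg : PowerSeries.constantCoeff g = 0) (f : ℂ⟦X⟧) :
    evalSeries g f = f.subst g := by
  ext m
  rw [PowerSeries.coeff_subst' (PowerSeries.HasSubst.of_constantCoeff_zero' hg), evalSeries,
    PowerSeries.coeff_mk]
  refine (finsum_eq_sum_of_support_subset _ fun j hj => ?_).symm
  by_contra hj'
  exact hj (by simp only [coeff_pow_eq_zero hg (show m < j by simpa using hj'), smul_zero])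

/-- `PowerSeries.log ℂ` is the series of log(1+X). Its exponential G solves (1+X)G' = G with G(0) =
1, and 1+X is the only solution. -/
theorem evalSeries_log_exp :
    evalSeries (PowerSeries.log ℂ) (PowerSeries.exp ℂ) = 1 + PowerSeries.X := by
  have hL : PowerSeries.constantCoeff (PowerSeries.log ℂ) = 0 := PowerSeries.constantCoeff_log
  have hd : (1 + PowerSeries.X) * PowerSeries.derivative ℂ (PowerSeries.log ℂ) = 1 := by
    rw [PowerSeries.deriv_log]
    ext m
    rcases m with _ | m
    · simp [add_mul]
    · simp [add_mul, PowerSeries.coeff_succ_X_mul, pow_succ, PowerSeries.coeff_one]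
  set G := evalSeries (PowerSeries.log ℂ) (PowerSeries.exp ℂ) with hG
  have hG' : (1 + PowerSeries.X) * PowerSeries.derivative ℂ G = G := by
    rw [hG, evalSeries_eq_subst hL,
      PowerSeries.derivative_subst (PowerSeries.HasSubst.of_constantCoeff_zero' hL),
      PowerSeries.derivative_exp, mul_left_comm, hd, mul_one]
  have h0 : PowerSeries.coeff 0 G = 1 := by
    rw [hG, PowerSeries.coeff_zero_eq_constantCoeff_apply, constantCoeff_evalSeries]; simp
  -- Comparison of coefficients in (1+X)G' = G; the factor 1 - m vanishes at m = 1 and kills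
  -- everything from X² on.
  have hrec : ∀ m : ℕ, ((m : ℂ) + 1) * PowerSeries.coeff (m + 1) G
      = (1 - m) * PowerSeries.coeff m G := fun m => by
    have := congrArg (PowerSeries.coeff m) hG'
    rcases m with _ | m
    · rw [add_mul, one_mul, map_add, PowerSeries.coeff_zero_X_mul, PowerSeries.coeff_derivative,
        add_zero] at this
      simpa using this
    · simp only [add_mul, one_mul, map_add, PowerSeries.coeff_succ_X_mul,
        PowerSeries.coeff_derivative] at this
      push_cast at this ⊢
      linear_combination this
  have h1 : PowerSeries.coeff 1 G = 1 := by simpa [h0] using hrec 0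
  have h2 : ∀ m : ℕ, PowerSeries.coeff (m + 2) G = 0 := fun m => by
    induction m with
    | zero => simpa using hrec 1
    | succ m ih =>
      have := hrec (m + 2)
      rw [ih, mul_zero] at this
      refine (mul_eq_zero.1 this).resolve_left ?_
      exact Nat.cast_add_one_ne_zero _
  ext m
  rcases m with _ | _ | m
  · simpa using h0
  · simpa [PowerSeries.coeff_one] using h1
  · rw [h2]; simp [PowerSeries.coeff_one, PowerSeries.coeff_X]

theorem fexp_eq_evalSeries (W : A⟦X⟧) : fexp W = evalSeries W (PowerSeries.exp ℂ) := by
  ext m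
  simp [fexp, evalSeries, PowerSeries.coeff_exp]

theorem flog_eq_evalSeries (P : A⟦X⟧) : flog P = evalSeries (P - 1) (PowerSeries.log ℂ) := by
  ext m
  rw [flog, evalSeries, PowerSeries.coeff_mk, PowerSeries.coeff_mk, Finset.range_eq_Ico,
    Finset.sum_eq_sum_Ico_succ_bot (Nat.succ_pos m)]
  rw [show Finset.Icc 1 m = Finset.Ico (0 + 1) (m + 1) by ext; simp]
  simp only [PowerSeries.coeff_log, if_true, zero_smul, zero_add]
  refine Finset.sum_congr rfl fun j hj => ?_
  rw [if_neg (by have := (Finset.mem_Ico.1 hj).1; omega)]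
  simp

theorem constantCoeff_fexp (W : A⟦X⟧) : PowerSeries.constantCoeff (fexp W) = 1 := by
  rw [fexp_eq_evalSeries, constantCoeff_evalSeries]; simp

theorem constantCoeff_flog (P : A⟦X⟧) : PowerSeries.constantCoeff (flog P) = 0 := by
  rw [flog_eq_evalSeries, constantCoeff_evalSeries]; simp

theorem fexp_flog {P : A⟦X⟧} (hP : PowerSeries.constantCoeff P = 1) : fexp (flog P) = P := by
  have hV : PowerSeries.constantCoeff (P - 1) = 0 := by simp [hP]
  rw [fexp_eq_evalSeries, flog_eq_evalSeries,
    evalSeries_evalSeries hV _ PowerSeries.constantCoeff_log, evalSeries_log_exp]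
  have h1 : evalSeries (P - 1) (1 + PowerSeries.X) = 1 + evalSeries (P - 1) PowerSeries.X :=
    (map_add (evalHom (P - 1) hV) 1 PowerSeries.X).trans (by rw [map_one]; rfl)
  rw [h1, evalSeries_X hV, add_sub_cancel]

theorem fexp_smul (c : ℂ) (W : A⟦X⟧) :
    fexp (c • W) = evalSeries W (PowerSeries.rescale c (PowerSeries.exp ℂ)) := by
  rw [fexp_eq_evalSeries]
  ext m
  simp only [evalSeries, PowerSeries.coeff_mk, PowerSeries.coeff_rescale, smul_pow,
    PowerSeries.coeff_smul]
  exact Finset.sum_congr rfl fun j _ => by rw [smul_smul, mul_comm]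

/-- Both exponents are multiples of the same W, so the functional equation of the scalar exponential
can be substituted. -/
theorem fexp_smul_mul_fexp_smul {W : A⟦X⟧} (hW : PowerSeries.constantCoeff W = 0) (a b : ℂ) :
    fexp (a • W) * fexp (b • W) = fexp ((a + b) • W) := by
  rw [fexp_smul, fexp_smul, fexp_smul, ← evalSeries_mul hW, PowerSeries.exp_mul_exp_eq_exp_add]

theorem fexp_zero : fexp (0 : A⟦X⟧) = 1 := by
  rw [fexp_eq_evalSeries, ← map_one (evalHom (0 : A⟦X⟧) (map_zero _))]
  ext m
  refine (coeff_evalSeries (map_zero _) _ (Nat.lt_succ_self m)).trans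
    (Eq.trans ?_ (coeff_evalSeries (map_zero _) _ (Nat.lt_succ_self m)).symm)
  refine Finset.sum_congr rfl fun j _ => ?_
  rcases j with _ | j
  · simp
  · simp

theorem fexp_mul_fexp_neg {W : A⟦X⟧} (hW : PowerSeries.constantCoeff W = 0) :
    fexp W * fexp (-W) = 1 := by
  have := fexp_smul_mul_fexp_smul hW 1 (-1)
  simpa [fexp_zero] using this

/-! ### Agreement up to a power of `h` -/

theorem cmul_eq_smul (c : ℂ) (P : A⟦X⟧) : cmul c P = c • P := by
  ext m; simp [cmul]

namespace EqUpTo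

variable {m a b : ℕ} {P P' Q Q' R : A⟦X⟧}

theorem refl (m : ℕ) (P : A⟦X⟧) : EqUpTo m P P := fun _ _ => rfl

theorem symm (h : EqUpTo m P Q) : EqUpTo m Q P := fun i hi => (h i hi).symm

theorem trans (h : EqUpTo m P Q) (h' : EqUpTo m Q R) : EqUpTo m P R :=
  fun i hi => (h i hi).trans (h' i hi)

theorem mono (h : EqUpTo a P Q) (hab : b ≤ a) : EqUpTo b P Q := fun i hi => h i (hi.trans_le hab)

theorem add (h : EqUpTo m P Q) (h' : EqUpTo m P' Q') : EqUpTo m (P + P') (Q + Q') :=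
  fun i hi => by rw [map_add, map_add, h i hi, h' i hi]

theorem smul (c : ℂ) (h : EqUpTo m P Q) : EqUpTo m (c • P) (c • Q) :=
  fun i hi => by rw [PowerSeries.coeff_smul, PowerSeries.coeff_smul, h i hi]

theorem sum {ι : Type*} (s : Finset ι) {P Q : ι → A⟦X⟧} (h : ∀ j ∈ s, EqUpTo m (P j) (Q j)) :
    EqUpTo m (∑ j ∈ s, P j) (∑ j ∈ s, Q j) :=
  fun i hi => by rw [map_sum, map_sum]; exact Finset.sum_congr rfl fun j hj => h j hj i hi

theorem mul (h : EqUpTo m P Q) (h' : EqUpTo m P' Q') : EqUpTo m (P * P') (Q * Q') :=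
  fun i hi => by
    rw [PowerSeries.coeff_mul, PowerSeries.coeff_mul]
    refine Finset.sum_congr rfl fun x hx => ?_
    have := Finset.HasAntidiagonal.mem_antidiagonal.1 hx
    rw [h _ (by omega), h' _ (by omega)]

theorem mul_zero_zero (h : EqUpTo a P 0) (h' : EqUpTo b Q 0) : EqUpTo (a + b) (P * Q) 0 :=
  fun i hi => by
    rw [PowerSeries.coeff_mul, map_zero]
    refine Finset.sum_eq_zero fun x hx => ?_
    have := Finset.HasAntidiagonal.mem_antidiagonal.1 hx
    rcases lt_or_ge x.1 a with hx | hx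
    · rw [h _ hx, map_zero, zero_mul]
    · rw [h' _ (by omega), map_zero, mul_zero]

theorem pow_zero (h : EqUpTo a P 0) (j : ℕ) : EqUpTo (j * a) (P ^ j) 0 := by
  induction j with
  | zero => intro i hi; omega
  | succ j ih => rw [pow_succ, Nat.succ_mul]; exact ih.mul_zero_zero h

theorem constantCoeff (h : EqUpTo m P Q) (hm : 0 < m) :
    PowerSeries.constantCoeff P = PowerSeries.constantCoeff Q := by
  simpa using h 0 hm

theorem eq (h : ∀ m, EqUpTo m P Q) : P = Q := by ext i; exact h (i + 1) i (Nat.lt_succ_self i)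

end EqUpTo

/-- The inner terms of the Cauchy product cancel; only the two end terms, where the m-th coefficient
meets a constant coefficient, can differ. -/
theorem coeff_mul_eq_of_eqUpTo {m : ℕ} {P P' Q Q' : A⟦X⟧} (hP : EqUpTo m P P')
    (hQ : EqUpTo m Q Q') (hm : 0 < m) :
    PowerSeries.coeff m (P * Q) - PowerSeries.coeff m (P' * Q')
      = (PowerSeries.coeff m P - PowerSeries.coeff m P') * PowerSeries.constantCoeff Q'
        + PowerSeries.constantCoeff P' * (PowerSeries.coeff m Q - PowerSeries.coeff m Q') := by
  obtain ⟨m, rfl⟩ := Nat.exists_eq_succ_of_ne_zero hm.ne'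
  have h0 : PowerSeries.coeff 0 P = PowerSeries.coeff 0 P' := hP 0 hm
  have h0' : PowerSeries.coeff 0 Q = PowerSeries.coeff 0 Q' := hQ 0 hm
  have hmul : ∀ R T : A⟦X⟧, PowerSeries.coeff (m + 1) (R * T)
      = ∑ k ∈ Finset.range m, PowerSeries.coeff (k + 1) R * PowerSeries.coeff (m + 1 - (k + 1)) T
        + PowerSeries.coeff 0 R * PowerSeries.coeff (m + 1) T
        + PowerSeries.coeff (m + 1) R * PowerSeries.coeff 0 T := fun R T => by
    rw [PowerSeries.coeff_mul, Finset.Nat.sum_antidiagonal_eq_sum_range_succ_mk,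
      Finset.sum_range_succ, Finset.sum_range_succ', Nat.sub_self, Nat.sub_zero]
  have : ∑ k ∈ Finset.range m, PowerSeries.coeff (k + 1) P * PowerSeries.coeff (m + 1 - (k + 1)) Q
      = ∑ k ∈ Finset.range m, PowerSeries.coeff (k + 1) P'
        * PowerSeries.coeff (m + 1 - (k + 1)) Q' :=
    Finset.sum_congr rfl fun k hk => by
      have := Finset.mem_range.1 hk
      rw [hP _ (by omega), hQ _ (by omega)]
  rw [hmul, hmul, this, h0, h0', ← PowerSeries.coeff_zero_eq_constantCoeff_apply,
    ← PowerSeries.coeff_zero_eq_constantCoeff_apply]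
  noncomm_ring

/-- Only the linear term of the exponential sees the first discrepancy: in powers of degree at least
2 it is multiplied by a vanishing constant coefficient. -/
theorem coeff_fexp_sub_coeff_fexp {m : ℕ} {W V : A⟦X⟧} (h : EqUpTo m W V)
    (hW : PowerSeries.constantCoeff W = 0) (hV : PowerSeries.constantCoeff V = 0) :
    PowerSeries.coeff m (fexp W) - PowerSeries.coeff m (fexp V)
      = PowerSeries.coeff m W - PowerSeries.coeff m V := by
  rcases Nat.eq_zero_or_pos m with rfl | hm
  · simp [constantCoeff_fexp, hW, hV]
  have hpow : ∀ j, EqUpTo m (W ^ j) (V ^ j) := fun j => by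
    induction j with
    | zero => simpa using EqUpTo.refl m 1
    | succ j ih => rw [pow_succ, pow_succ]; exact ih.mul h
  -- The cut-off m + 2 allows the terms j = 0 and j = 1 to be split off.
  rw [fexp_eq_evalSeries, fexp_eq_evalSeries,
    coeff_evalSeries hW _ (show m < m + 2 by omega), coeff_evalSeries hV _ (show m < m + 2 by omega),
    ← Finset.sum_sub_distrib, Finset.sum_range_succ', Finset.sum_range_succ', Finset.sum_eq_zero]
  · simp
  · intro j _
    rw [← smul_sub, pow_succ W, pow_succ V, coeff_mul_eq_of_eqUpTo (hpow _) h hm, pow_succ V,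
      map_mul PowerSeries.constantCoeff, hV]
    simp

/-- The first discrepancy passes through the exponential unchanged, so the coefficients of the
exponent are recovered one by one. -/
theorem eqUpTo_of_fexp {m : ℕ} {W V : A⟦X⟧} (h : EqUpTo m (fexp W) (fexp V))
    (hW : PowerSeries.constantCoeff W = 0) (hV : PowerSeries.constantCoeff V = 0) :
    EqUpTo m W V := by
  induction m with
  | zero => intro i hi; omega
  | succ m ih =>
    have hm := ih (h.mono (Nat.le_succ m))
    intro i hi
    rcases Nat.lt_succ_iff_lt_or_eq.1 hi with hi | rfl
    · exact hm i hi
    · have := coeff_fexp_sub_coeff_fexp hm hW hV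
      rwa [h i (Nat.lt_succ_self i), sub_self, eq_comm, sub_eq_zero] at this

theorem fexp_injective {W V : A⟦X⟧} (h : fexp W = fexp V)
    (hW : PowerSeries.constantCoeff W = 0) (hV : PowerSeries.constantCoeff V = 0) : W = V :=
  EqUpTo.eq fun m => eqUpTo_of_fexp (h ▸ EqUpTo.refl m _) hW hV

/-- Injectivity of the exponential makes the right inverse `fexp_flog` a left inverse as well. -/
theorem flog_fexp {W : A⟦X⟧} (hW : PowerSeries.constantCoeff W = 0) : flog (fexp W) = W :=
  fexp_injective (fexp_flog (constantCoeff_fexp W)) (constantCoeff_flog _) hW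

theorem flog_congr {m : ℕ} {P Q : A⟦X⟧} (h : EqUpTo m P Q)
    (hP : PowerSeries.constantCoeff P = 1) (hQ : PowerSeries.constantCoeff Q = 1) :
    EqUpTo m (flog P) (flog Q) :=
  eqUpTo_of_fexp (by rwa [fexp_flog hP, fexp_flog hQ]) (constantCoeff_flog _) (constantCoeff_flog _)

theorem coeff_flog_sub_coeff_flog {m : ℕ} {P Q : A⟦X⟧} (h : EqUpTo m P Q)
    (hP : PowerSeries.constantCoeff P = 1) (hQ : PowerSeries.constantCoeff Q = 1) :
    PowerSeries.coeff m (flog P) - PowerSeries.coeff m (flog Q)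
      = PowerSeries.coeff m P - PowerSeries.coeff m Q := by
  rw [← coeff_fexp_sub_coeff_fexp (flog_congr h hP hQ) (constantCoeff_flog _)
    (constantCoeff_flog _), fexp_flog hP, fexp_flog hQ]

/-- `exp V = 1 + V + V² / 2 + O(h ^ (3 a))` if `V = O(h ^ a)`. -/
theorem fexp_eqUpTo_quadratic {a : ℕ} (ha : 0 < a) {V : A⟦X⟧} (h : EqUpTo a V 0) :
    EqUpTo (3 * a) (fexp V) (1 + V + (1 / 2 : ℂ) • (V * V)) := fun i hi => by
  have hV : PowerSeries.constantCoeff V = 0 := by simpa using h.constantCoeff ha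
  rw [fexp_eq_evalSeries, coeff_evalSeries hV _ (show i < i + 3 by omega),
    Finset.sum_range_succ', Finset.sum_range_succ', Finset.sum_range_succ', Finset.sum_eq_zero]
  · simp [PowerSeries.coeff_exp, pow_two]
    abel
  · intro j _
    rw [h.pow_zero (j + 1 + 1 + 1) i (hi.trans_le (Nat.mul_le_mul_right a (by omega))), map_zero,
      smul_zero]

/-! ### Rescaling of the variable -/

/-- The series `P(a h)`. -/
def scaleSeries (a : ℂ) (P : A⟦X⟧) : A⟦X⟧ :=
  PowerSeries.mk fun m => a ^ m • PowerSeries.coeff m P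

@[simp] theorem coeff_scaleSeries (a : ℂ) (P : A⟦X⟧) (m : ℕ) :
    PowerSeries.coeff m (scaleSeries a P) = a ^ m • PowerSeries.coeff m P := by
  simp [scaleSeries]

theorem scaleSeries_mul (a : ℂ) (P Q : A⟦X⟧) :
    scaleSeries a (P * Q) = scaleSeries a P * scaleSeries a Q := by
  ext m
  simp only [coeff_scaleSeries, PowerSeries.coeff_mul, Finset.smul_sum]
  refine Finset.sum_congr rfl fun x hx => ?_
  rw [← Finset.HasAntidiagonal.mem_antidiagonal.1 hx, pow_add, smul_mul_smul_comm]

theorem scaleSeries_one (a : ℂ) : scaleSeries a (1 : A⟦X⟧) = 1 := by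
  ext m
  rcases m with _ | m <;> simp [PowerSeries.coeff_one]

theorem scaleSeries_pow (a : ℂ) (P : A⟦X⟧) (j : ℕ) :
    scaleSeries a (P ^ j) = scaleSeries a P ^ j := by
  induction j with
  | zero => simp [scaleSeries_one]
  | succ j ih => rw [pow_succ, pow_succ, scaleSeries_mul, ih]

theorem scaleSeries_scaleSeries (a b : ℂ) (P : A⟦X⟧) :
    scaleSeries a (scaleSeries b P) = scaleSeries (a * b) P := by
  ext m; simp [smul_smul, mul_pow]

theorem fexp_scaleSeries (a : ℂ) (W : A⟦X⟧) : fexp (scaleSeries a W) = scaleSeries a (fexp W) := by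
  ext m
  simp only [fexp, coeff_scaleSeries, PowerSeries.coeff_mk, ← scaleSeries_pow, Finset.smul_sum]
  exact Finset.sum_congr rfl fun j _ => smul_comm _ _ _

theorem constantCoeff_scaleSeries (a : ℂ) (P : A⟦X⟧) :
    PowerSeries.constantCoeff (scaleSeries a P) = PowerSeries.constantCoeff P := by
  rw [← PowerSeries.coeff_zero_eq_constantCoeff_apply, coeff_scaleSeries, pow_zero, one_smul,
    PowerSeries.coeff_zero_eq_constantCoeff_apply]

theorem EqUpTo.scaleSeries {m : ℕ} {P Q : A⟦X⟧} (h : EqUpTo m P Q) (a : ℂ) :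
    EqUpTo m (scaleSeries a P) (scaleSeries a Q) := fun i hi => by simp [h i hi]

end FormalSeries

/-! ### Taylor expansions in the step size -/

section Taylor

variable {E F : Type*} [NormedAddCommGroup E] [NormedSpace ℂ E]
  [NormedAddCommGroup F] [NormedSpace ℂ F]

/-- The `m`-th Taylor coefficient at `0`. -/
def taylorCoeff (m : ℕ) (a : ℂ → ℂ) : ℂ := ((m.factorial : ℂ)⁻¹) * iteratedDeriv m a 0

theorem taylorCoeff_congr {a b : ℂ → ℂ} (h : a =ᶠ[𝓝 0] b) (m : ℕ) :
    taylorCoeff m a = taylorCoeff m b := by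
  rw [taylorCoeff, taylorCoeff, h.iteratedDeriv_eq]

theorem taylorCoeff_succ (m : ℕ) (a : ℂ → ℂ) :
    ((m : ℂ) + 1) * taylorCoeff (m + 1) a = taylorCoeff m (deriv a) := by
  rw [taylorCoeff, taylorCoeff, iteratedDeriv_succ', Nat.factorial_succ]
  have : ((m : ℂ) + 1) ≠ 0 := Nat.cast_add_one_ne_zero m
  push_cast
  field_simp

/-- A property that holds near `(0, z)` holds on a product of balls. -/
theorem exists_ball_prod {z : E} {P : ℂ × E → Prop} (h : ∀ᶠ p in 𝓝 ((0 : ℂ), z), P p) :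
    ∃ ε > 0, ∀ (t : ℂ) (w : E), ‖t‖ < ε → ‖w - z‖ < ε → P (t, w) := by
  obtain ⟨ε, hε, h⟩ := Metric.eventually_nhds_iff.1 h
  refine ⟨ε, hε, fun t w ht hw => h ?_⟩
  rw [Prod.dist_eq, dist_zero_right, dist_eq_norm]
  exact max_lt ht hw

theorem eventually_of_ball_prod {z : E} {P : ℂ × E → Prop} {ε : ℝ} (hε : 0 < ε)
    (h : ∀ (t : ℂ) (w : E), ‖t‖ < ε → ‖w - z‖ < ε → P (t, w)) : ∀ᶠ p in 𝓝 ((0 : ℂ), z), P p := by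
  refine Metric.eventually_nhds_iff.2 ⟨ε, hε, fun p hp => ?_⟩
  rw [Prod.dist_eq, dist_zero_right, dist_eq_norm] at hp
  exact h p.1 p.2 ((le_max_left _ _).trans_lt hp) ((le_max_right _ _).trans_lt hp)

theorem hasDerivAt_left {G : ℂ × E → F} {t : ℂ} {w : E} (h : AnalyticAt ℂ G (t, w)) :
    HasDerivAt (fun s => G (s, w)) (fderiv ℂ G (t, w) (1, 0)) t :=
  h.differentiableAt.hasFDerivAt.comp_hasDerivAt t
    ((hasDerivAt_id t).prodMk (hasDerivAt_const t w))

/-- Taylor's formula, locally uniformly in the parameter. -/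
theorem isBigO_taylor {z : E} {G : ℂ × E → ℂ} (hG : AnalyticAt ℂ G (0, z)) (m : ℕ) :
    (fun p : ℂ × E => G p
      - ∑ i ∈ Finset.range m, p.1 ^ i * taylorCoeff i fun h => G (h, p.2))
      =O[𝓝 (0, z)] fun p => p.1 ^ m := by
  induction m generalizing G with
  | zero => simpa using hG.continuousAt.isBigO_one ℂ
  | succ m ih =>
    -- The step-size derivative is again jointly analytic. The induction hypothesis bounds its
    -- remainder by C‖t‖^m, and the mean value inequality from 0, where the remainder of G vanishes,
    -- gains one power of t.
    have hG' : AnalyticAt ℂ (fun p => fderiv ℂ G p ((1 : ℂ), (0 : E))) (0, z) :=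
      ((ContinuousLinearMap.apply ℂ ℂ ((1 : ℂ), (0 : E))).analyticAt _).fun_comp hG.fderiv
    obtain ⟨C, hC0, hC⟩ := (ih hG').exists_nonneg
    obtain ⟨ε, hε, h⟩ := exists_ball_prod (hC.bound.and hG.eventually_analyticAt)
    refine Asymptotics.IsBigO.of_bound C (eventually_of_ball_prod hε fun t w ht hw => ?_)
    have hcoeff : ∀ i : ℕ, ((i : ℂ) + 1) * taylorCoeff (i + 1) (fun h => G (h, w))
        = taylorCoeff i fun h => fderiv ℂ G (h, w) ((1 : ℂ), (0 : E)) := fun i => by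
      rw [taylorCoeff_succ]
      refine taylorCoeff_congr ?_ i
      filter_upwards [Metric.ball_mem_nhds (0 : ℂ) hε] with s hs
      exact (hasDerivAt_left (h s w (by simpa using hs) hw).2).deriv
    have hder : ∀ s ∈ Metric.closedBall (0 : ℂ) ‖t‖, HasDerivWithinAt
        (fun s => G (s, w) - ∑ i ∈ Finset.range (m + 1), s ^ i * taylorCoeff i fun h => G (h, w))
        (fderiv ℂ G (s, w) (1, 0) - ∑ i ∈ Finset.range m,
          s ^ i * taylorCoeff i fun h => fderiv ℂ G (h, w) ((1 : ℂ), (0 : E)))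
        (Metric.closedBall (0 : ℂ) ‖t‖) s := fun s hs => by
      have hs' : ‖s‖ < ε := lt_of_le_of_lt (by simpa using hs) ht
      refine HasDerivAt.hasDerivWithinAt ((hasDerivAt_left (h s w hs' hw).2).sub ?_)
      have hsum : HasDerivAt (fun s : ℂ => ∑ i ∈ Finset.range (m + 1),
          s ^ i * taylorCoeff i fun h => G (h, w))
          (∑ i ∈ Finset.range (m + 1), (i * s ^ (i - 1)) * taylorCoeff i fun h => G (h, w)) s :=
        HasDerivAt.fun_sum fun i _ => (hasDerivAt_pow i s).mul_const _
      refine hsum.congr_deriv ?_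
      rw [Finset.sum_range_succ']
      simp only [← hcoeff, Nat.cast_zero, zero_mul, add_zero, Nat.add_sub_cancel]
      refine Finset.sum_congr rfl fun i _ => ?_
      push_cast
      ring
    have hmv := Convex.norm_image_sub_le_of_norm_hasDerivWithin_le (C := C * ‖t‖ ^ m) hder
      (fun s hs => by
        have hs' : ‖s‖ ≤ ‖t‖ := by simpa using hs
        have hb := (h s w (hs'.trans_lt ht) hw).1
        rw [norm_pow] at hb
        exact hb.trans (by gcongr))
      (convex_closedBall (0 : ℂ) ‖t‖) (show (0 : ℂ) ∈ Metric.closedBall (0 : ℂ) ‖t‖ by simp)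
      (show t ∈ Metric.closedBall (0 : ℂ) ‖t‖ by simp)
    have h0 : G (0, w) - ∑ i ∈ Finset.range (m + 1), (0 : ℂ) ^ i * taylorCoeff i (fun h => G (h, w))
        = 0 := by
      rw [Finset.sum_range_succ']
      simp [taylorCoeff]
    simp only [h0, sub_zero] at hmv
    rwa [norm_pow, pow_succ, ← mul_assoc]

/-- Two Taylor polynomials that agree to high order along real step sizes are equal. -/
theorem eq_zero_of_sum_isBigO {m : ℕ} {b : ℕ → ℂ}
    (h : (fun t : ℝ => ∑ i ∈ Finset.range m, (t : ℂ) ^ i * b i)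
      =O[𝓝[≠] 0] fun t : ℝ => t ^ m) : ∀ i < m, b i = 0 := by
  induction m generalizing b with
  | zero => intro i hi; omega
  | succ m ih =>
    have hb0 : b 0 = 0 := by
      have h1 : Tendsto (fun t : ℝ => ∑ i ∈ Finset.range (m + 1), (t : ℂ) ^ i * b i)
          (𝓝[≠] 0) (𝓝 0) := by
        refine h.trans_tendsto ?_
        have : Tendsto (fun t : ℝ => t ^ (m + 1)) (𝓝 0) (𝓝 (0 ^ (m + 1))) :=
          (continuous_pow (m + 1)).tendsto 0
        rw [zero_pow (Nat.succ_ne_zero m)] at this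
        exact this.mono_left nhdsWithin_le_nhds
      have h2 : Tendsto (fun t : ℝ => ∑ i ∈ Finset.range (m + 1), (t : ℂ) ^ i * b i)
          (𝓝[≠] 0) (𝓝 (∑ i ∈ Finset.range (m + 1), ((0 : ℝ) : ℂ) ^ i * b i)) :=
        (Continuous.tendsto (by fun_prop) 0).mono_left nhdsWithin_le_nhds
      have := tendsto_nhds_unique h2 h1
      rw [Finset.sum_range_succ'] at this
      simpa using this
    -- Once b 0 = 0, one factor t is cancelled; this is why the estimate lives on the punctured
    -- neighbourhood.
    have hs : (fun t : ℝ => ∑ i ∈ Finset.range m, (t : ℂ) ^ i * b (i + 1))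
        =O[𝓝[≠] 0] fun t : ℝ => t ^ m := by
      obtain ⟨C, hC⟩ := h.bound
      refine Asymptotics.IsBigO.of_bound C ?_
      filter_upwards [hC, self_mem_nhdsWithin] with t ht ht0
      rw [Finset.sum_range_succ', hb0, mul_zero, add_zero] at ht
      have : ∑ i ∈ Finset.range m, (t : ℂ) ^ (i + 1) * b (i + 1)
          = t * ∑ i ∈ Finset.range m, (t : ℂ) ^ i * b (i + 1) := by
        rw [Finset.mul_sum]
        exact Finset.sum_congr rfl fun i _ => by ring
      rw [this, norm_mul, pow_succ', norm_mul, Complex.norm_real, mul_left_comm] at ht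
      exact le_of_mul_le_mul_left ht (norm_pos_iff.2 ht0)
    intro i hi
    rcases i with _ | i
    · exact hb0
    · exact ih hs i (by omega)

theorem isBigO_taylor_real {a : ℂ → ℂ} (ha : AnalyticAt ℂ a 0) (m : ℕ) :
    (fun t : ℝ => a t - ∑ i ∈ Finset.range m, (t : ℂ) ^ i * taylorCoeff i a)
      =O[𝓝 0] fun t : ℝ => t ^ m := by
  have hG : AnalyticAt ℂ (fun p : ℂ × ℂ => a p.1) ((0 : ℂ), (0 : ℂ)) :=
    AnalyticAt.fun_comp (f := Prod.fst) (x := ((0 : ℂ), (0 : ℂ))) ha analyticAt_fst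
  have ht : Tendsto (fun t : ℝ => ((t : ℂ), (0 : ℂ))) (𝓝 0) (𝓝 ((0 : ℂ), (0 : ℂ))) :=
    Continuous.tendsto' (by fun_prop) _ _ (by simp)
  refine ((isBigO_taylor hG m).comp_tendsto ht).trans (Asymptotics.IsBigO.of_bound 1 ?_)
  simp

/-- Uniqueness of Taylor coefficients along real step sizes. -/
theorem taylorCoeff_eq_of_isBigO {a : ℂ → ℂ} (ha : AnalyticAt ℂ a 0) {m : ℕ} {b : ℕ → ℂ}
    (h : (fun t : ℝ => a t - ∑ i ∈ Finset.range m, (t : ℂ) ^ i * b i)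
      =O[𝓝 0] fun t : ℝ => t ^ m) {i : ℕ} (hi : i < m) : taylorCoeff i a = b i := by
  have h2 := (h.sub (isBigO_taylor_real ha m)).mono (nhdsWithin_le_nhds (s := {0}ᶜ))
  refine sub_eq_zero.1 (eq_zero_of_sum_isBigO (b := fun i => taylorCoeff i a - b i)
    (h2.congr_left fun t => ?_) i hi)
  simp only [mul_sub, Finset.sum_sub_distrib]
  ring

theorem taylorCoeff_eq_of_eventually_real {a b : ℂ → ℂ} (ha : AnalyticAt ℂ a 0)
    (hb : AnalyticAt ℂ b 0) (h : ∀ᶠ t : ℝ in 𝓝 0, a t = b t) (i : ℕ) :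
    taylorCoeff i a = taylorCoeff i b :=
  taylorCoeff_eq_of_isBigO (b := fun i => taylorCoeff i b) ha
    ((isBigO_taylor_real hb (i + 1)).congr' (h.mono fun t ht => by simp only [ht])
      EventuallyEq.rfl) (Nat.lt_succ_self i)

theorem isBigO_of_taylorCoeff_eq_zero {z : E} {G : ℂ × E → ℂ} (hG : AnalyticAt ℂ G (0, z))
    {m : ℕ} (h : ∀ᶠ w in 𝓝 z, ∀ i < m, taylorCoeff i (fun t => G (t, w)) = 0) :
    G =O[𝓝 (0, z)] fun p => p.1 ^ m := by
  refine (isBigO_taylor hG m).congr' ?_ EventuallyEq.rfl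
  filter_upwards [(continuous_snd.tendsto ((0 : ℂ), z)).eventually h] with p hp
  rw [Finset.sum_eq_zero fun i hi => by rw [hp i (Finset.mem_range.1 hi), mul_zero], sub_zero]

/-- An analytic function of one variable with vanishing Taylor coefficients vanishes. -/
theorem eventually_eq_zero_of_taylorCoeff {a : ℂ → ℂ} (ha : AnalyticAt ℂ a 0)
    (h : ∀ i, taylorCoeff i a = 0) : ∀ᶠ t in 𝓝 0, a t = 0 := by
  by_contra hne
  -- If a does not vanish near 0, then a(t) = tⁿ g(t) with g(0) ≠ 0; Taylor's formula at order n + 1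
  -- along real t forces g(0) = 0.
  obtain ⟨n, g, hg, hg0, hgn⟩ := ha.exists_eventuallyEq_pow_smul_nonzero_iff.2 hne
  have hO := isBigO_taylor_real ha (n + 1)
  simp only [h, mul_zero, Finset.sum_const_zero, sub_zero] at hO
  have hcast : Tendsto (fun t : ℝ => (t : ℂ)) (𝓝 0) (𝓝 0) :=
    Complex.continuous_ofReal.tendsto' _ _ (by simp)
  obtain ⟨C, hC⟩ := hO.bound
  have h1 : Tendsto (fun t : ℝ => g t) (𝓝[≠] 0) (𝓝 (g 0)) :=
    (hg.continuousAt.tendsto.comp hcast).mono_left nhdsWithin_le_nhds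
  have h2 : Tendsto (fun t : ℝ => g t) (𝓝[≠] 0) (𝓝 0) := by
    refine squeeze_zero_norm' (a := fun t : ℝ => C * |t|) ?_ ?_
    · filter_upwards [hC.filter_mono nhdsWithin_le_nhds,
        (hcast.eventually hgn).filter_mono nhdsWithin_le_nhds, self_mem_nhdsWithin] with t h3 h4 h5
      rw [h4, sub_zero, smul_eq_mul, norm_mul, norm_pow, norm_pow, Complex.norm_real, pow_succ,
        mul_left_comm] at h3
      exact le_of_mul_le_mul_left h3 (pow_pos (norm_pos_iff.2 h5) n)
    · have : Tendsto (fun t : ℝ => C * |t|) (𝓝 0) (𝓝 0) :=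
        Continuous.tendsto' (by fun_prop) _ _ (by simp)
      exact this.mono_left nhdsWithin_le_nhds
  exact hg0 (tendsto_nhds_unique h1 h2)

/-- A jointly analytic function whose Taylor coefficients in the step size vanish for all
parameters near `z` vanishes near `(0, z)`. -/
theorem eventually_eq_zero_of_taylorCoeff_prod {z : E} {G : ℂ × E → ℂ}
    (hG : AnalyticAt ℂ G (0, z))
    (h : ∀ᶠ w in 𝓝 z, ∀ i, taylorCoeff i (fun t => G (t, w)) = 0) :
    ∀ᶠ p in 𝓝 (0, z), G p = 0 := by
  obtain ⟨ε, hε, hb⟩ := exists_ball_prod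
    (hG.eventually_analyticAt.and ((continuous_snd.tendsto ((0 : ℂ), z)).eventually h))
  refine eventually_of_ball_prod hε fun t w ht hw => ?_
  -- The radius ε does not depend on w, so the identity theorem on this disc yields vanishing on a
  -- full product neighbourhood.
  have han : AnalyticOnNhd ℂ (fun s => G (s, w)) (Metric.ball 0 ε) := fun s hs =>
    AnalyticAt.fun_comp (f := fun s : ℂ => (s, w)) (hb s w (by simpa using hs) hw).1
      (by fun_prop)
  have h0 : (0 : ℂ) ∈ Metric.ball (0 : ℂ) ε := Metric.mem_ball_self hε
  exact han.eqOn_zero_of_preconnected_of_eventuallyEq_zero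
    (convex_ball (0 : ℂ) ε).isPreconnected h0
    (eventually_eq_zero_of_taylorCoeff (han 0 h0) (hb 0 w (by simpa using hε) hw).2)
    (by simpa using ht)

/-- Cauchy's estimate: spatial derivatives inherit bounds in the step size. -/
theorem isBigO_fderiv [CompleteSpace F] {z : E} {D : ℂ × E → F} (hD : AnalyticAt ℂ D (0, z)) {m : ℕ}
    (h : D =O[𝓝 (0, z)] fun p => p.1 ^ m) :
    (fun p : ℂ × E => fderiv ℂ (fun w => D (p.1, w)) p.2) =O[𝓝 (0, z)] fun p => p.1 ^ m := by
  obtain ⟨C, hC0, hC⟩ := h.exists_nonneg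
  obtain ⟨ε, hε, hb⟩ := exists_ball_prod (hC.bound.and hD.eventually_analyticAt)
  refine Asymptotics.IsBigO.of_bound (2 * C / (ε / 2))
    (eventually_of_ball_prod (half_pos hε) fun t w ht hw => ?_)
  have hball : ∀ w' ∈ Metric.ball w (ε / 2), ‖w' - z‖ < ε := fun w' hw' => by
    calc ‖w' - z‖ = ‖(w' - w) + (w - z)‖ := by congr 1; abel
      _ ≤ ‖w' - w‖ + ‖w - z‖ := norm_add_le _ _
      _ < ε / 2 + ε / 2 := add_lt_add (by simpa [dist_eq_norm] using hw') hw
      _ = ε := add_halves ε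
  have ht' : ‖t‖ < ε := ht.trans (half_lt_self hε)
  -- D(t, ·) maps the ball of radius ε/2 about w into a ball about D(t, w); the factor 2 in its
  -- radius is the triangle inequality.
  have := Complex.norm_fderiv_le_div_of_mapsTo_ball (f := fun w => D (t, w)) (c := w)
    (R₁ := ε / 2) (R₂ := 2 * (C * ‖t ^ m‖)) (fun w' hw' => ?_) (fun w' hw' => ?_) (half_pos hε)
  · refine this.trans (le_of_eq ?_)
    ring
  · have h1 := (hb t w' ht' (hball w' hw')).2
    exact (AnalyticAt.fun_comp (f := fun w : E => (t, w)) h1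
      (by fun_prop)).differentiableAt.differentiableWithinAt
  · rw [Metric.mem_closedBall, dist_eq_norm, two_mul]
    exact (norm_sub_le _ _).trans (add_le_add (hb t w' ht' (hball w' hw')).1
      (hb t w ht' (hball w (Metric.mem_ball_self (half_pos hε)))).1)

end Taylor

/-! ### The series of operators of a method -/

section OpSeries

variable {d : ℕ} {U : TopologicalSpace.Opens (Fin d → ℂ)}

theorem op_ext {D D' : Op U} (h : ∀ g : HolFun U, ∀ z ∈ U, (D g).1 z = (D' g).1 z) : D = D' := by
  ext g z
  by_cases hz : z ∈ U
  · exact h g z hz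
  · rw [(D g).2.2 z hz, (D' g).2.2 z hz]

namespace Integrator

theorem analyticAt_comp (M : Integrator U) (g : HolFun U) {z : Fin d → ℂ} (hz : z ∈ U) :
    AnalyticAt ℂ (fun p : ℂ × (Fin d → ℂ) => g.1 (M.toFun p.1 p.2)) (0, z) :=
  AnalyticAt.fun_comp_of_eq (g.2.1 z hz) (M.analytic z hz) (M.map_zero z hz)

theorem analyticAt_time (M : Integrator U) (g : HolFun U) {z : Fin d → ℂ} (hz : z ∈ U) :
    AnalyticAt ℂ (fun h : ℂ => g.1 (M.toFun h z)) 0 :=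
  AnalyticAt.fun_comp (f := fun h : ℂ => (h, z)) (M.analyticAt_comp g hz) (by fun_prop)

theorem tendsto_prod (M : Integrator U) {z : Fin d → ℂ} (hz : z ∈ U) :
    Tendsto (fun p : ℂ × (Fin d → ℂ) => M.toFun p.1 p.2) (𝓝 (0, z)) (𝓝 z) := by
  have := (M.analytic z hz).continuousAt.tendsto
  rwa [M.map_zero z hz] at this

theorem tendsto_time (M : Integrator U) {z : Fin d → ℂ} (hz : z ∈ U) :
    Tendsto (fun h : ℂ => M.toFun h z) (𝓝 0) (𝓝 z) :=
  (M.tendsto_prod hz).comp (Continuous.tendsto (f := fun h : ℂ => (h, z)) (by fun_prop) 0)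

theorem tendsto_real (M : Integrator U) {z : Fin d → ℂ} (hz : z ∈ U) :
    Tendsto (fun h : ℝ => M.toFun h z) (𝓝 0) (𝓝 z) :=
  (M.tendsto_time hz).comp (Complex.continuous_ofReal.tendsto' _ _ (by simp))

theorem opCoeff_apply (M : Integrator U) (m : ℕ) (g : HolFun U) {z : Fin d → ℂ} (hz : z ∈ U) :
    (M.opCoeff m g).1 z = taylorCoeff m fun h => g.1 (M.toFun h z) := by
  have hz' : z ∈ (U : Set (Fin d → ℂ)) := hz
  simp [opCoeff, hz', taylorCoeff]

theorem coeff_opSeries (M : Integrator U) (m : ℕ) :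
    PowerSeries.coeff m M.opSeries = M.opCoeff m := by
  simp [opSeries]

theorem coeff_opSeries_apply (M : Integrator U) (m : ℕ) (g : HolFun U) {z : Fin d → ℂ}
    (hz : z ∈ U) :
    (PowerSeries.coeff m M.opSeries g).1 z = taylorCoeff m fun h => g.1 (M.toFun h z) := by
  rw [coeff_opSeries, opCoeff_apply _ _ _ hz]

/-- Taylor coefficients are determined by real step sizes, which is all that the symmetry and
reality hypotheses control. -/
theorem opSeries_eq_of_eventually {M N : Integrator U}
    (h : ∀ z ∈ U, ∀ᶠ t : ℝ in 𝓝 0, M.toFun t z = N.toFun t z) : M.opSeries = N.opSeries := by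
  ext1 m
  refine op_ext fun g z hz => ?_
  rw [coeff_opSeries_apply _ _ _ hz, coeff_opSeries_apply _ _ _ hz]
  exact taylorCoeff_eq_of_eventually_real (M.analyticAt_time g hz) (N.analyticAt_time g hz)
    ((h z hz).mono fun t ht => by rw [ht]) m

theorem opSeries_one : (one U).opSeries = 1 := by
  ext1 m
  refine op_ext fun g z hz => ?_
  rw [coeff_opSeries_apply _ _ _ hz, PowerSeries.coeff_one]
  simp only [one, taylorCoeff, iteratedDeriv_const]
  by_cases hm : m = 0 <;> simp [hm]

/-- The series of a composition is the product of the series in the reversed order. -/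
theorem opSeries_comp (M N : Integrator U) :
    (M.comp N).opSeries = N.opSeries * M.opSeries := by
  ext1 m
  refine op_ext fun g z hz => ?_
  rw [coeff_opSeries_apply _ _ _ hz, PowerSeries.coeff_mul, ← Finset.Nat.sum_antidiagonal_swap,
    Finset.Nat.sum_antidiagonal_eq_sum_range_succ_mk]
  refine (taylorCoeff_eq_of_isBigO (m := m + 1) (b := fun r => ∑ k ∈ Finset.range (r + 1),
    (N.opCoeff (r - k) (M.opCoeff k g)).1 z) ((M.comp N).analyticAt_time g hz) ?_
    (Nat.lt_succ_self m)).trans ?_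
  · have htend : Tendsto (fun t : ℝ => ((t : ℂ), N.toFun t z)) (𝓝 0) (𝓝 (0, z)) :=
      Tendsto.prodMk_nhds (Complex.continuous_ofReal.tendsto' _ _ (by simp)) (N.tendsto_real hz)
    -- The base point N_t(z) moves with t, so Taylor's formula is needed uniformly in the space
    -- variable.
    have h1 : (fun t : ℝ => g.1 (M.toFun t (N.toFun t z)) - ∑ i ∈ Finset.range (m + 1),
        (t : ℂ) ^ i * (M.opCoeff i g).1 (N.toFun t z)) =O[𝓝 0] fun t : ℝ => t ^ (m + 1) := by
      refine ((isBigO_taylor (M.analyticAt_comp g hz) (m + 1)).comp_tendsto htend).congr'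
        ?_ EventuallyEq.rfl |>.trans (Asymptotics.IsBigO.of_bound 1 ?_)
      · filter_upwards [(N.tendsto_real hz).eventually (U.isOpen.mem_nhds hz)] with t ht
        simp only [Function.comp_apply]
        refine congrArg _ (Finset.sum_congr rfl fun i _ => ?_)
        rw [opCoeff_apply _ _ _ ht]
      · simp
    -- Each coefficient of the outer expansion is itself a holomorphic function, expanded along N up
    -- to the complementary order.
    have h2 : ∀ i ∈ Finset.range (m + 1), (fun t : ℝ => (t : ℂ) ^ i *
        ((M.opCoeff i g).1 (N.toFun t z) - ∑ l ∈ Finset.range (m + 1 - i),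
          (t : ℂ) ^ l * (N.opCoeff l (M.opCoeff i g)).1 z)) =O[𝓝 0] fun t : ℝ => t ^ (m + 1) :=
      fun i hi => by
        have h3 := isBigO_taylor_real (N.analyticAt_time (M.opCoeff i g) hz) (m + 1 - i)
        have h4 : (fun t : ℝ => (t : ℂ) ^ i) =O[𝓝 0] fun t : ℝ => t ^ i :=
          Asymptotics.IsBigO.of_bound 1 (by simp)
        refine (h4.mul h3).congr (fun t => ?_) (fun t => ?_)
        · simp only [opCoeff_apply _ _ _ hz]
        · rw [← pow_add, Nat.add_sub_cancel' (Finset.mem_range.1 hi).le]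
    refine (h1.add (Asymptotics.IsBigO.sum h2)).congr_left fun t => ?_
    simp only [Finset.sum_apply, mul_sub, Finset.sum_sub_distrib, comp, Finset.mul_sum]
    rw [sub_add_sub_cancel, ← Finset.sum_range_diag_flip]
    refine congrArg _ (Finset.sum_congr rfl fun r _ => Finset.sum_congr rfl fun k hk => ?_)
    rw [← mul_assoc, ← pow_add, Nat.add_sub_cancel' (Nat.lt_succ_iff.1 (Finset.mem_range.1 hk))]
  · simp [coeff_opSeries]

theorem opSeries_scale (M : Integrator U) (a : ℂ) :
    (M.scale a).opSeries = scaleSeries a M.opSeries := by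
  ext1 m
  refine op_ext fun g z hz => ?_
  rw [coeff_opSeries_apply _ _ _ hz]
  erw [coeff_scaleSeries]
  refine (taylorCoeff_eq_of_isBigO (m := m + 1) (b := fun r => a ^ r * (M.opCoeff r g).1 z)
    ((M.scale a).analyticAt_time g hz) ?_ (Nat.lt_succ_self m)).trans (by simp [coeff_opSeries])
  have htend : Tendsto (fun t : ℝ => (a * (t : ℂ), z)) (𝓝 0) (𝓝 (0, z)) :=
    Continuous.tendsto' (by fun_prop) _ _ (by simp)
  refine ((isBigO_taylor (M.analyticAt_comp g hz) (m + 1)).comp_tendsto htend).congr_left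
    (fun t => ?_) |>.trans (Asymptotics.IsBigO.of_bound (‖a‖ ^ (m + 1)) ?_)
  · simp only [Function.comp_apply, scale, opCoeff_apply _ _ _ hz]
    refine congrArg _ (Finset.sum_congr rfl fun i _ => ?_)
    ring
  · simp [mul_pow]

/-- For real t, conjugating a Taylor polynomial conjugates its coefficients, and the remainder keeps
its norm. -/
theorem opSeries_conj (hU : ∀ z ∈ U, star z ∈ U) (M : Integrator U) :
    (M.conj hU).opSeries = conjSeries hU M.opSeries := by
  ext1 m
  refine op_ext fun g z hz => ?_
  rw [coeff_opSeries_apply _ _ _ hz]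
  refine (taylorCoeff_eq_of_isBigO (m := m + 1)
    (b := fun r => star ((M.opCoeff r (conjFun hU g)).1 (star z)))
    ((M.conj hU).analyticAt_time g hz) ?_ (Nat.lt_succ_self m)).trans
    (by simp [conjSeries, coeff_opSeries, conjOp, conjFun])
  have := isBigO_taylor_real (M.analyticAt_time (conjFun hU g) (hU z hz)) (m + 1)
  refine Asymptotics.IsBigO.trans (Asymptotics.IsBigO.of_bound 1 (Eventually.of_forall fun t => ?_))
    this
  rw [one_mul, ← norm_star (_ - _)]
  simp [conj, conjFun, opCoeff_apply _ _ _ (hU z hz)]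

/-- For a time-symmetric method, `P(-h) P(h) = 1`. -/
theorem scaleSeries_neg_one_mul_opSeries {S : Integrator U} (h : IsTimeSymmetric U S.toFun) :
    scaleSeries (-1) S.opSeries * S.opSeries = 1 := by
  rw [← opSeries_scale, ← opSeries_comp, ← opSeries_one]
  refine opSeries_eq_of_eventually fun z hz => (h z hz).mono fun t ht => ?_
  simpa [comp, scale, one] using ht

theorem opSeries_mul_scaleSeries_neg_one {S : Integrator U} (h : IsTimeSymmetric U S.toFun) :
    S.opSeries * scaleSeries (-1) S.opSeries = 1 := by
  have := congrArg (scaleSeries (-1)) (scaleSeries_neg_one_mul_opSeries h)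
  rw [scaleSeries_mul, scaleSeries_scaleSeries, scaleSeries_one] at this
  convert this
  ext1 m
  erw [coeff_scaleSeries]
  simp

theorem conjSeries_opSeries {S : Integrator U} (hU : ∀ z ∈ U, star z ∈ U)
    (h : IsRealMethod U S.toFun) : conjSeries hU S.opSeries = S.opSeries := by
  rw [← opSeries_conj]
  refine opSeries_eq_of_eventually fun z hz => (h z hz).mono fun t ht => ?_
  simp [conj, ht]

end Integrator

/-! ### Lie series -/

theorem lieDeriv_apply {f : (Fin d → ℂ) → (Fin d → ℂ)} (hf : AnalyticOnNhd ℂ f U) (g : HolFun U)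
    {z : Fin d → ℂ} (hz : z ∈ U) : (lieDeriv f hf g).1 z = fderiv ℂ g.1 z (f z) := by
  have hz' : z ∈ (U : Set (Fin d → ℂ)) := hz
  simp [lieDeriv, hz']

theorem monomial_one_pow {A : Type*} [Ring A] (a : A) (j : ℕ) :
    (PowerSeries.monomial 1 a : A⟦X⟧) ^ j = PowerSeries.monomial j (a ^ j) := by
  induction j with
  | zero => simp
  | succ j ih => rw [pow_succ, ih, PowerSeries.monomial_mul_monomial, pow_succ]

theorem constantCoeff_monomial_one {A : Type*} [Ring A] (a : A) :
    PowerSeries.constantCoeff (PowerSeries.monomial 1 a : A⟦X⟧) = 0 := by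
  rw [← PowerSeries.coeff_zero_eq_constantCoeff_apply, PowerSeries.coeff_monomial,
    if_neg zero_ne_one]

theorem monomial_smul {A : Type*} [Ring A] [Algebra ℂ A] (m : ℕ) (c : ℂ) (a : A) :
    (PowerSeries.monomial m (c • a) : A⟦X⟧) = c • PowerSeries.monomial m a := by
  ext i
  by_cases h : i = m <;> simp [PowerSeries.coeff_monomial, h]

/-- The series `exp (c h D)` over an arbitrary algebra. -/
def expSeries {A : Type*} [Ring A] [Algebra ℂ A] (c : ℂ) (D : A) : A⟦X⟧ :=
  fexp (PowerSeries.monomial 1 (c • D))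

theorem expStep_eq_expSeries (c : ℂ) (D : Op U) : expStep c D = expSeries c D := rfl

section ExpSeries

variable {A : Type*} [Ring A] [Algebra ℂ A]

theorem coeff_expSeries (c : ℂ) (D : A) (m : ℕ) :
    PowerSeries.coeff m (expSeries c D) = (c ^ m / (m.factorial : ℂ)) • D ^ m := by
  rw [expSeries, fexp, PowerSeries.coeff_mk, Finset.sum_eq_single m]
  · rw [monomial_one_pow, PowerSeries.coeff_monomial, if_pos rfl, smul_pow, smul_smul]
    congr 1
    ring
  · intro j _ hj
    rw [monomial_one_pow, PowerSeries.coeff_monomial, if_neg hj.symm, smul_zero]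
  · simp

theorem expSeries_mul_expSeries (a b : ℂ) (D : A) :
    expSeries a D * expSeries b D = expSeries (a + b) D := by
  simp only [expSeries, monomial_smul]
  exact fexp_smul_mul_fexp_smul (constantCoeff_monomial_one D) a b

theorem expSeries_zero (D : A) : expSeries 0 D = 1 := by
  simp [expSeries, fexp_zero]

theorem constantCoeff_expSeries (c : ℂ) (D : A) :
    PowerSeries.constantCoeff (expSeries c D) = 1 := constantCoeff_fexp _

theorem scaleSeries_expSeries (a c : ℂ) (D : A) :
    scaleSeries a (expSeries c D) = expSeries (a * c) D := by
  ext1 m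
  rw [coeff_scaleSeries, coeff_expSeries, coeff_expSeries, smul_smul, mul_pow, mul_div_assoc]

end ExpSeries

/-- The Taylor expansion of a function along a solution of the differential equation. -/
theorem isBigO_lieSeries {f : (Fin d → ℂ) → (Fin d → ℂ)} (hf : AnalyticOnNhd ℂ f U)
    {x : ℝ → (Fin d → ℂ)} (hx0 : x 0 ∈ U) (hx : ∀ᶠ t in 𝓝 (0 : ℝ), HasDerivAt x (f (x t)) t)
    (g : HolFun U) (m : ℕ) :
    (fun t : ℝ => g.1 (x t) - ∑ i ∈ Finset.range m,
      (t : ℂ) ^ i * (((i.factorial : ℂ)⁻¹) * ((lieDeriv f hf ^ i) g).1 (x 0)))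
      =O[𝓝 0] fun t : ℝ => t ^ m := by
  have hcont : ContinuousAt x 0 := hx.self_of_nhds.continuousAt
  induction m generalizing g with
  | zero =>
    have : ContinuousAt (fun t => g.1 (x t)) 0 := (g.2.1 _ hx0).continuousAt.comp hcont
    simpa using this.isBigO_one ℝ
  | succ m ih =>
    -- Along a solution the derivative of g(x(t)) is (Fg)(x(t)), so the remainder for Fg is the
    -- derivative of the remainder for g.
    obtain ⟨C, hC0, hC⟩ := (ih (lieDeriv f hf g)).exists_nonneg
    obtain ⟨ε, hε, h⟩ := Metric.eventually_nhds_iff.1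
      (hC.bound.and (hx.and (hcont.eventually (U.isOpen.mem_nhds hx0))))
    refine Asymptotics.IsBigO.of_bound C (Metric.eventually_nhds_iff.2 ⟨ε, hε, fun t ht => ?_⟩)
    have hder : ∀ s ∈ Metric.closedBall (0 : ℝ) ‖t‖, HasDerivWithinAt
        (fun s : ℝ => g.1 (x s) - ∑ i ∈ Finset.range (m + 1),
          (s : ℂ) ^ i * (((i.factorial : ℂ)⁻¹) * ((lieDeriv f hf ^ i) g).1 (x 0)))
        ((lieDeriv f hf g).1 (x s) - ∑ i ∈ Finset.range m,
          (s : ℂ) ^ i * (((i.factorial : ℂ)⁻¹) * ((lieDeriv f hf ^ i) (lieDeriv f hf g)).1 (x 0)))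
        (Metric.closedBall (0 : ℝ) ‖t‖) s := fun s hs => by
      have hs' : dist s 0 < ε := lt_of_le_of_lt (by simpa using hs) ht
      obtain ⟨-, hxs, hxU⟩ := h hs'
      have h1 : HasDerivAt (fun s : ℝ => g.1 (x s)) ((lieDeriv f hf g).1 (x s)) s := by
        rw [lieDeriv_apply hf g hxU]
        exact ((g.2.1 _ hxU).differentiableAt.hasFDerivAt.restrictScalars ℝ).comp_hasDerivAt s hxs
      have h2 : HasDerivAt (fun s : ℝ => ∑ i ∈ Finset.range (m + 1),
          (s : ℂ) ^ i * (((i.factorial : ℂ)⁻¹) * ((lieDeriv f hf ^ i) g).1 (x 0)))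
          (∑ i ∈ Finset.range (m + 1), (i * (s : ℂ) ^ (i - 1)) *
            (((i.factorial : ℂ)⁻¹) * ((lieDeriv f hf ^ i) g).1 (x 0))) s :=
        HasDerivAt.fun_sum fun i _ => ((hasDerivAt_pow i (s : ℂ)).comp_ofReal).mul_const _
      refine (h1.sub (h2.congr_deriv ?_)).hasDerivWithinAt
      rw [Finset.sum_range_succ']
      simp only [Nat.cast_zero, zero_mul, add_zero, Nat.add_sub_cancel]
      refine Finset.sum_congr rfl fun i _ => ?_
      have hi : ((i : ℂ) + 1) ≠ 0 := Nat.cast_add_one_ne_zero i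
      have hi' : (i.factorial : ℂ) ≠ 0 := Nat.cast_ne_zero.2 i.factorial_ne_zero
      rw [Nat.factorial_succ, pow_succ (lieDeriv f hf) i, Module.End.mul_apply]
      push_cast
      field_simp
    have hmv := Convex.norm_image_sub_le_of_norm_hasDerivWithin_le (C := C * ‖t‖ ^ m) hder
      (fun s hs => by
        have hs' : ‖s‖ ≤ ‖t‖ := by simpa using hs
        have hb := (h (show dist s 0 < ε by
          rw [dist_zero_right]; exact hs'.trans_lt (by simpa using ht))).1
        rw [norm_pow] at hb
        exact hb.trans (by gcongr))
      (convex_closedBall (0 : ℝ) ‖t‖)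
      (show (0 : ℝ) ∈ Metric.closedBall (0 : ℝ) ‖t‖ by simp)
      (show t ∈ Metric.closedBall (0 : ℝ) ‖t‖ by simp)
    have h0 : g.1 (x 0) - ∑ i ∈ Finset.range (m + 1), ((0 : ℝ) : ℂ) ^ i *
        (((i.factorial : ℂ)⁻¹) * ((lieDeriv f hf ^ i) g).1 (x 0)) = 0 := by
      rw [Finset.sum_range_succ']
      simp
    simp only [h0, sub_zero] at hmv
    rwa [norm_pow, pow_succ, ← mul_assoc]

/-- The series of a method of order `r` agrees with the Lie series up to `O(h ^ (r + 1))`. -/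
theorem opSeries_eqUpTo_expStep {f : (Fin d → ℂ) → (Fin d → ℂ)} (hf : AnalyticOnNhd ℂ f U)
    {S : Integrator U} {r : ℕ} (hS : HasOrder U f S.toFun r) :
    EqUpTo (r + 1) S.opSeries (expStep 1 (lieDeriv f hf)) := by
  intro i hi
  refine op_ext fun g z hz => ?_
  rw [Integrator.coeff_opSeries_apply _ _ _ hz, expStep_eq_expSeries]
  erw [coeff_expSeries]
  -- `HasOrder` quantifies over solutions; the Picard–Lindelöf theorem supplies one through z.
  obtain ⟨x, hx0, ε, hε, hx⟩ :=
    ((hf z hz).contDiffAt.restrict_scalars ℝ : ContDiffAt ℝ 1 f z)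
      |>.exists_forall_mem_closedBall_exists_eq_forall_mem_Ioo_hasDerivAt₀ 0
  have hx' : ∀ᶠ t in 𝓝 (0 : ℝ), HasDerivAt x (f (x t)) t := by
    filter_upwards [Ioo_mem_nhds (show (0 : ℝ) - ε < 0 by linarith) (show (0 : ℝ) < 0 + ε by linarith)]
      with t ht using hx t ht
  have hord := hS z hz x hx0 hx'
  have h1 : (fun t : ℝ => g.1 (S.toFun t z) - g.1 (x t)) =O[𝓝 0] fun t : ℝ => t ^ (r + 1) := by
    have hxt : Tendsto x (𝓝 0) (𝓝 z) := by
      have := hx'.self_of_nhds.continuousAt.tendsto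
      rwa [hx0] at this
    exact ((g.2.1 z hz).hasStrictFDerivAt.isBigO_sub.comp_tendsto
      ((S.tendsto_real hz).prodMk_nhds hxt)).trans hord
  have h2 := isBigO_lieSeries hf (by rwa [hx0]) hx' g (r + 1)
  rw [hx0] at h2
  refine (taylorCoeff_eq_of_isBigO (S.analyticAt_time g hz)
    ((h1.add h2).congr_left fun t => sub_add_sub_cancel _ _ _) hi).trans ?_
  simp [div_eq_mul_inv]

end OpSeries

/-! ### Symmetric-conjugate compositions in an abstract algebra -/

section Compositions

variable {A : Type*} [Ring A] [Algebra ℂ A]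

theorem eqUpTo_monomial (N : ℕ) (y : A) : EqUpTo N (PowerSeries.monomial N y) 0 := fun i hi => by
  rw [PowerSeries.coeff_monomial, if_neg hi.ne, map_zero]

theorem EqUpTo.of_sub {m : ℕ} {P Q : A⟦X⟧} (h : EqUpTo m (P - Q) 0) : EqUpTo m P Q :=
  fun i hi => by simpa [sub_eq_zero] using h i hi

theorem EqUpTo.sub_zero {m : ℕ} {P Q : A⟦X⟧} (h : EqUpTo m P Q) : EqUpTo m (P - Q) 0 :=
  fun i hi => by simp [h i hi]

theorem eqUpTo_one {P Q : A⟦X⟧}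
    (h : PowerSeries.constantCoeff P = PowerSeries.constantCoeff Q) : EqUpTo 1 P Q := fun i hi => by
  obtain rfl : i = 0 := by omega
  simpa using h

/-- A factor 1 + O(h) changes y h^N only by O(h^{N+1}). -/
theorem eqUpTo_mul_monomial {Q : A⟦X⟧} (hQ : PowerSeries.constantCoeff Q = 1) (N : ℕ) (y : A) :
    EqUpTo (N + 1) (Q * PowerSeries.monomial N y) (PowerSeries.monomial N y) := by
  refine EqUpTo.of_sub ?_
  have h := (eqUpTo_one (P := Q) (Q := 1) (by simpa using hQ)).sub_zero.mul_zero_zero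
    (eqUpTo_monomial N y)
  rwa [sub_mul, one_mul, add_comm] at h

theorem eqUpTo_monomial_mul {Q : A⟦X⟧} (hQ : PowerSeries.constantCoeff Q = 1) (N : ℕ) (y : A) :
    EqUpTo (N + 1) (PowerSeries.monomial N y * Q) (PowerSeries.monomial N y) := by
  refine EqUpTo.of_sub ?_
  have h := (eqUpTo_monomial N y).mul_zero_zero
    (eqUpTo_one (P := Q) (Q := 1) (by simpa using hQ)).sub_zero
  rwa [mul_sub, mul_one] at h

/-- The series of the composition with coefficients `l` of the method with series `P`. -/
def compSeries (P : A⟦X⟧) : List ℂ → A⟦X⟧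
  | [] => 1
  | a :: l => compSeries P l * scaleSeries a P

/-- The order is reversed because maps act contravariantly on functions. -/
theorem compSeries_append (P : A⟦X⟧) (l l' : List ℂ) :
    compSeries P (l ++ l') = compSeries P l' * compSeries P l := by
  induction l with
  | nil => simp [compSeries]
  | cons a l ih => rw [List.cons_append, compSeries, ih, compSeries, mul_assoc]

theorem constantCoeff_compSeries {P : A⟦X⟧} (hP : PowerSeries.constantCoeff P = 1) (l : List ℂ) :
    PowerSeries.constantCoeff (compSeries P l) = 1 := by
  induction l with
  | nil => simp [compSeries]
  | cons a l ih => rw [compSeries, map_mul, ih, constantCoeff_scaleSeries, hP, one_mul]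

theorem scaleSeries_monomial (a : ℂ) (N : ℕ) (y : A) :
    scaleSeries a (PowerSeries.monomial N y) = PowerSeries.monomial N (a ^ N • y) := by
  ext i
  by_cases h : i = N <;> simp [PowerSeries.coeff_monomial, h]

theorem scaleSeries_add (a : ℂ) (P Q : A⟦X⟧) :
    scaleSeries a (P + Q) = scaleSeries a P + scaleSeries a Q := by
  ext i; simp

theorem flog_expSeries (F : A) : flog (expSeries 1 F) = PowerSeries.monomial 1 F := by
  rw [expSeries, one_smul, flog_fexp (constantCoeff_monomial_one F)]

theorem flog_one : flog (1 : A⟦X⟧) = 0 := by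
  rw [← fexp_zero, flog_fexp (map_zero _)]

variable {P : A⟦X⟧} {F : A} {N : ℕ}

/-- The first discrepancy between P and exp(hF) passes unchanged through the logarithm, and log
exp(hF) = hF has no term at h^N because N ≥ 2. -/
theorem eqUpTo_leading (hP : EqUpTo N P (expSeries 1 F)) (hN : 2 ≤ N) :
    EqUpTo (N + 1) P
      (expSeries 1 F + PowerSeries.monomial N (PowerSeries.coeff N (flog P))) := by
  have hP1 : PowerSeries.constantCoeff P = 1 :=
    (hP.constantCoeff (by omega)).trans (constantCoeff_expSeries 1 F)
  intro i hi
  rw [map_add, PowerSeries.coeff_monomial]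
  rcases Nat.lt_succ_iff_lt_or_eq.1 hi with hi | rfl
  · rw [if_neg hi.ne, add_zero, hP i hi]
  · have := coeff_flog_sub_coeff_flog hP hP1 (constantCoeff_expSeries 1 F)
    rw [flog_expSeries, PowerSeries.coeff_monomial, if_neg (by omega), _root_.sub_zero] at this
    rw [if_pos rfl, this, add_sub_cancel]

/-- The leading terms of a composition. -/
theorem compSeries_eqUpTo (hP : EqUpTo N P (expSeries 1 F)) (hN : 2 ≤ N) (l : List ℂ) :
    EqUpTo (N + 1) (compSeries P l) (expSeries l.sum F +
      PowerSeries.monomial N ((l.map (· ^ N)).sum • PowerSeries.coeff N (flog P))) := by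
  set Y := PowerSeries.coeff N (flog P)
  induction l with
  | nil => simpa [compSeries, expSeries_zero] using EqUpTo.refl _ _
  | cons a l ih =>
    have h1 : EqUpTo (N + 1) (scaleSeries a P)
        (expSeries a F + PowerSeries.monomial N (a ^ N • Y)) := by
      have := (eqUpTo_leading hP hN).scaleSeries a
      rwa [scaleSeries_add, scaleSeries_expSeries, mul_one, scaleSeries_monomial] at this
    refine (ih.mul h1).trans ?_
    -- Of the four products, the exponentials merge, the two mixed ones reduce to their bare
    -- monomials, and the product of monomials is O(h^{2N}).
    rw [mul_add, add_mul, add_mul, expSeries_mul_expSeries, List.sum_cons, List.map_cons,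
      List.sum_cons, add_smul, map_add, add_comm a, add_assoc]
    refine (EqUpTo.refl _ _).add ?_
    rw [add_comm (PowerSeries.monomial N (a ^ N • Y))]
    refine (eqUpTo_monomial_mul (constantCoeff_expSeries a F) N _).add ?_
    have h2 : EqUpTo (N + 1) (PowerSeries.monomial N ((l.map (· ^ N)).sum • Y) *
        PowerSeries.monomial N (a ^ N • Y)) 0 :=
      ((eqUpTo_monomial N _).mul_zero_zero (eqUpTo_monomial N _)).mono (by omega)
    simpa using (eqUpTo_mul_monomial (constantCoeff_expSeries l.sum F) N (a ^ N • Y)).add h2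

/-- The product telescopes from the middle, each pair being P(ah)P(-ah) = 1. Thus the adjoint of a
composition has the reversed coefficients. -/
theorem compSeries_reverse_mul (hsymm : P * scaleSeries (-1) P = 1) (l : List ℂ) :
    compSeries P l.reverse * scaleSeries (-1) (compSeries P l) = 1 := by
  induction l with
  | nil => simp [compSeries, scaleSeries_one]
  | cons a l ih =>
    have h := congrArg (scaleSeries a) hsymm
    rw [scaleSeries_mul, scaleSeries_scaleSeries, scaleSeries_one] at h
    rw [List.reverse_cons, compSeries_append, compSeries, compSeries, compSeries, one_mul,
      scaleSeries_mul, scaleSeries_scaleSeries, mul_assoc, ← mul_assoc (compSeries P l.reverse), ih,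
      one_mul, mul_comm (-1 : ℂ) a, h]

/-! ### The central exponent -/

/-- The exponent `W` with `Ψ = exp (h F / 2) exp W exp (h F / 2)`. -/
def centralLog (F : A) (Ψ : A⟦X⟧) : A⟦X⟧ :=
  flog (expSeries (-1 / 2) F * Ψ * expSeries (-1 / 2) F)

theorem expSeries_half_mul_neg_half (F : A) : expSeries (1 / 2) F * expSeries (-1 / 2) F = 1 := by
  rw [expSeries_mul_expSeries, show (1 / 2 : ℂ) + -1 / 2 = 0 by norm_num, expSeries_zero]

theorem expSeries_neg_half_mul_half (F : A) : expSeries (-1 / 2) F * expSeries (1 / 2) F = 1 := by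
  rw [expSeries_mul_expSeries, show (-1 / 2 : ℂ) + 1 / 2 = 0 by norm_num, expSeries_zero]

theorem fexp_centralLog {Ψ : A⟦X⟧} (hΨ : PowerSeries.constantCoeff Ψ = 1) (F : A) :
    fexp (centralLog F Ψ) = expSeries (-1 / 2) F * Ψ * expSeries (-1 / 2) F := by
  refine fexp_flog ?_
  rw [map_mul, map_mul, constantCoeff_expSeries, hΨ, one_mul, one_mul]

theorem eq_mul_fexp_centralLog_mul {Ψ : A⟦X⟧} (hΨ : PowerSeries.constantCoeff Ψ = 1) (F : A) :
    Ψ = expSeries (1 / 2) F * fexp (centralLog F Ψ) * expSeries (1 / 2) F := by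
  rw [fexp_centralLog hΨ, mul_assoc (expSeries (-1 / 2) F), ← mul_assoc, ← mul_assoc,
    expSeries_half_mul_neg_half, one_mul, mul_assoc, expSeries_neg_half_mul_half, mul_one]

theorem constantCoeff_centralLog (F : A) (Ψ : A⟦X⟧) :
    PowerSeries.constantCoeff (centralLog F Ψ) = 0 := constantCoeff_flog _

/-- Multiplying exp(hF) + μ Y_N h^N on both sides by exp(-hF/2) leaves 1 + μ Y_N h^N up to
O(h^{N+1}), and the logarithm preserves this leading term. -/
theorem centralLog_leading (hP : EqUpTo N P (expSeries 1 F)) (hN : 2 ≤ N) {l : List ℂ}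
    (hl : l.sum = 1) :
    EqUpTo N (centralLog F (compSeries P l)) 0 ∧
    PowerSeries.coeff N (centralLog F (compSeries P l))
      = (l.map (· ^ N)).sum • PowerSeries.coeff N (flog P) := by
  set Y := PowerSeries.coeff N (flog P)
  have hP1 : PowerSeries.constantCoeff P = 1 :=
    (hP.constantCoeff (by omega)).trans (constantCoeff_expSeries 1 F)
  have hE := constantCoeff_expSeries (-1 / 2) F
  have h : EqUpTo (N + 1) (expSeries (-1 / 2) F * compSeries P l * expSeries (-1 / 2) F)
      (1 + PowerSeries.monomial N ((l.map (· ^ N)).sum • Y)) := by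
    refine (((EqUpTo.refl _ _).mul (compSeries_eqUpTo hP hN l)).mul (EqUpTo.refl _ _)).trans ?_
    rw [mul_add, add_mul, expSeries_mul_expSeries, expSeries_mul_expSeries, hl,
      show (-1 / 2 : ℂ) + 1 + -1 / 2 = 0 by norm_num, expSeries_zero]
    exact (EqUpTo.refl _ _).add ((((eqUpTo_mul_monomial hE N _)).mul (EqUpTo.refl _ _)).trans
      (eqUpTo_monomial_mul hE N _))
  have h0 : EqUpTo N (expSeries (-1 / 2) F * compSeries P l * expSeries (-1 / 2) F) 1 := by
    refine (h.mono (Nat.le_succ N)).trans ?_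
    simpa using (EqUpTo.refl N (1 : A⟦X⟧)).add (eqUpTo_monomial N ((l.map (· ^ N)).sum • Y))
  have hc : PowerSeries.constantCoeff
      (expSeries (-1 / 2) F * compSeries P l * expSeries (-1 / 2) F) = 1 := by
    rw [map_mul, map_mul, hE, constantCoeff_compSeries hP1, one_mul, one_mul]
  have h1 : PowerSeries.constantCoeff (1 : A⟦X⟧) = 1 := map_one _
  constructor
  · simpa [centralLog, flog_one] using flog_congr h0 hc h1
  · have := coeff_flog_sub_coeff_flog h0 hc h1
    rw [flog_one, map_zero, _root_.sub_zero] at this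
    rw [centralLog, this, h N (Nat.lt_succ_self N), map_add, add_sub_cancel_left,
      PowerSeries.coeff_monomial, if_pos rfl]

end Compositions

/-! ### Conjugate compositions -/

section Conjugation

variable {A : Type*} [Ring A] [Algebra ℂ A]

/-- Here σ abstracts the complex conjugation of operators: multiplicative, but antilinear, so
scalars come out conjugated. -/
theorem map_scaleSeries {σ : A →+* A} (hσ : ∀ (c : ℂ) (a : A), σ (c • a) = star c • σ a)
    (a : ℂ) (Q : A⟦X⟧) :
    PowerSeries.map σ (scaleSeries a Q) = scaleSeries (star a) (PowerSeries.map σ Q) := by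
  ext i; simp [hσ]

theorem map_fexp {σ : A →+* A} (hσ : ∀ (c : ℂ) (a : A), σ (c • a) = star c • σ a) (W : A⟦X⟧) :
    PowerSeries.map σ (fexp W) = fexp (PowerSeries.map σ W) := by
  ext i
  simp [fexp, hσ, ← map_pow]

theorem map_expSeries {σ : A →+* A} (hσ : ∀ (c : ℂ) (a : A), σ (c • a) = star c • σ a) {F : A}
    (hF : σ F = F) (c : ℂ) :
    PowerSeries.map σ (expSeries c F) = expSeries (star c) F := by
  rw [expSeries, map_fexp hσ, expSeries]
  congr 1
  ext i
  by_cases h : i = 1 <;> simp [PowerSeries.coeff_monomial, h, hσ, hF]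

theorem map_compSeries {σ : A →+* A} (hσ : ∀ (c : ℂ) (a : A), σ (c • a) = star c • σ a)
    {P : A⟦X⟧} (hP : PowerSeries.map σ P = P) (l : List ℂ) :
    PowerSeries.map σ (compSeries P l) = compSeries P (l.map star) := by
  induction l with
  | nil => simp [compSeries]
  | cons a l ih => rw [List.map_cons, compSeries, compSeries, map_mul, ih, map_scaleSeries hσ, hP]

/-- Since N ≥ 2, F is the coefficient of h in P, so it inherits the reality of P. -/
theorem map_eq_of_eqUpTo_expSeries {σ : A →+* A} {P : A⟦X⟧} {F : A} {N : ℕ} (hN : 2 ≤ N)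
    (hP : EqUpTo N P (expSeries 1 F)) (hPσ : PowerSeries.map σ P = P) : σ F = F := by
  have h1 : PowerSeries.coeff 1 P = F := by
    rw [hP 1 (by omega), coeff_expSeries]
    simp
  have := congrArg (PowerSeries.coeff 1) hPσ
  rwa [PowerSeries.coeff_map, h1] at this

/-- `W̄(h) = -W(-h)` for symmetric-conjugate compositions. -/
theorem map_centralLog {σ : A →+* A} (hσ : ∀ (c : ℂ) (a : A), σ (c • a) = star c • σ a)
    {P : A⟦X⟧} {F : A} {l : List ℂ} (hF : σ F = F) (hPσ : PowerSeries.map σ P = P)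
    (hP1 : PowerSeries.constantCoeff P = 1)
    (hsymm : P * scaleSeries (-1) P = 1) (hl : l.map star = l.reverse) :
    PowerSeries.map σ (centralLog F (compSeries P l))
      = -scaleSeries (-1) (centralLog F (compSeries P l)) := by
  set W := centralLog F (compSeries P l) with hWdef
  have hc := constantCoeff_compSeries hP1 l
  have hW : PowerSeries.constantCoeff W = 0 := constantCoeff_centralLog F _
  have hW' : PowerSeries.constantCoeff (scaleSeries (-1) W) = 0 := by
    rw [constantCoeff_scaleSeries, hW]
  have h1 : fexp (PowerSeries.map σ W)
      = expSeries (-1 / 2) F * compSeries P l.reverse * expSeries (-1 / 2) F := by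
    rw [← map_fexp hσ, hWdef, fexp_centralLog hc, map_mul, map_mul, map_expSeries hσ hF,
      map_compSeries hσ hPσ, hl]
    simp
  have h2 : fexp (scaleSeries (-1) W)
      = expSeries (1 / 2) F * scaleSeries (-1) (compSeries P l) * expSeries (1 / 2) F := by
    rw [fexp_scaleSeries, hWdef, fexp_centralLog hc, scaleSeries_mul, scaleSeries_mul,
      scaleSeries_expSeries]
    norm_num
  -- The two inner half steps cancel, and the reversed composition at h then meets the original one
  -- at -h. So exp W̄(h) is inverse to exp W(-h), and injectivity of the exponential finishes.
  have h3 : fexp (PowerSeries.map σ W) * fexp (scaleSeries (-1) W) = 1 := by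
    rw [h1, h2]
    calc _ = expSeries (-1 / 2) F * compSeries P l.reverse *
          (expSeries (-1 / 2) F * expSeries (1 / 2) F) * scaleSeries (-1) (compSeries P l) *
          expSeries (1 / 2) F := by simp only [mul_assoc]
      _ = expSeries (-1 / 2) F * (compSeries P l.reverse * scaleSeries (-1) (compSeries P l)) *
          expSeries (1 / 2) F := by rw [expSeries_neg_half_mul_half, mul_one]; simp only [mul_assoc]
      _ = 1 := by rw [compSeries_reverse_mul hsymm, mul_one, expSeries_neg_half_mul_half]
  refine fexp_injective ?_ ?_ (by rw [map_neg, hW', neg_zero])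
  · calc fexp (PowerSeries.map σ W)
        = fexp (PowerSeries.map σ W) * (fexp (scaleSeries (-1) W) * fexp (-scaleSeries (-1) W)) := by
          rw [fexp_mul_fexp_neg hW', mul_one]
      _ = fexp (-scaleSeries (-1) W) := by rw [← mul_assoc, h3, one_mul]
  · rw [← PowerSeries.coeff_zero_eq_constantCoeff_apply, PowerSeries.coeff_map,
      PowerSeries.coeff_zero_eq_constantCoeff_apply, hW, map_zero]

/-! ### Averages of exponentials -/

section Averages

variable {W V : A⟦X⟧} {N : ℕ}

theorem coeff_add_eq_zero_of_even (h : V = -scaleSeries (-1) W) {m : ℕ} (hm : Even m) :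
    PowerSeries.coeff m (W + V) = 0 := by
  rw [h, map_add, map_neg, coeff_scaleSeries, hm.neg_one_pow, one_smul, add_neg_cancel]

/-- At the odd power N the two signs in -W(-h) cancel, so the leading terms coincide and V - W gains
one order. -/
theorem eqUpTo_succ_of_odd (h : V = -scaleSeries (-1) W) (hW : EqUpTo N W 0) (hN : Odd N) :
    EqUpTo (N + 1) V W := fun i hi => by
  rw [h, map_neg, coeff_scaleSeries]
  rcases Nat.lt_succ_iff_lt_or_eq.1 hi with hi | rfl
  · rw [hW i hi, map_zero, smul_zero, neg_zero]
  · rw [hN.neg_one_pow, neg_smul, one_smul, neg_neg]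

theorem EqUpTo.of_eq {m : ℕ} {P Q : A⟦X⟧} (h : P = Q) : EqUpTo m P Q := h ▸ EqUpTo.refl m P

theorem EqUpTo.add_zero_zero {m : ℕ} {P Q : A⟦X⟧} (h : EqUpTo m P 0) (h' : EqUpTo m Q 0) :
    EqUpTo m (P + Q) 0 := by simpa using h.add h'

theorem EqUpTo.smul_zero {m : ℕ} {P : A⟦X⟧} (c : ℂ) (h : EqUpTo m P 0) : EqUpTo m (c • P) 0 := by
  simpa using h.smul c

/-- The mean of two exponentials with nearly equal exponents. -/
theorem half_fexp_add_fexp_eqUpTo (hN : 2 ≤ N) (hW : EqUpTo N W 0) (hVW : EqUpTo (N + 1) V W) :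
    EqUpTo (2 * N + 2) ((1 / 2 : ℂ) • (fexp W + fexp V)) (fexp ((1 / 2 : ℂ) • (W + V))) := by
  have hV : EqUpTo N V 0 := (hVW.mono (Nat.le_succ N)).trans hW
  have hle : 2 * N + 2 ≤ 3 * N := by omega
  have hN0 : 0 < N := by omega
  have h1 := (fexp_eqUpTo_quadratic hN0 hW).mono hle
  have h2 := (fexp_eqUpTo_quadratic hN0 hV).mono hle
  have h3 := (fexp_eqUpTo_quadratic hN0 ((hW.add_zero_zero hV).smul_zero (1 / 2))).mono hle
  -- The second-order parts differ by exactly (V - W)²/8, even without commutativity; cubic terms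
  -- are negligible because 3N ≥ 2N + 2.
  have h4 : EqUpTo (2 * N + 2) ((1 / 8 : ℂ) • ((V - W) * (V - W))) 0 :=
    ((hVW.sub_zero.mul_zero_zero hVW.sub_zero).mono (by omega)).smul_zero _
  refine ((h1.add h2).smul (1 / 2)).trans (EqUpTo.trans ?_ h3.symm)
  refine EqUpTo.of_sub ?_
  convert h4 using 1
  simp only [mul_add, add_mul, mul_sub, sub_mul, smul_mul_assoc, mul_smul_comm]
  module

/-- The linear parts of the mean and of the exponential of the mean cancel; the quadratic parts
leave half the variance of the μ_j, times Y². -/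
theorem mean_fexp_eqUpTo {k : ℕ} (hk : 1 ≤ k) (hN : 2 ≤ N) {B : Fin k → A⟦X⟧} {μ : Fin k → ℂ}
    {Y : A} (hB : ∀ j, EqUpTo (N + 2) (B j) (PowerSeries.monomial N (μ j • Y))) :
    EqUpTo (2 * N + 2) ((1 / k : ℂ) • ∑ j, fexp (B j))
      (fexp ((1 / k : ℂ) • ∑ j, B j) + PowerSeries.monomial (2 * N)
        ((1 / (2 * k) * (∑ j, μ j ^ 2 - 1 / k * (∑ j, μ j) ^ 2) : ℂ) • Y ^ 2)) := by
  have hk0 : (k : ℂ) ≠ 0 := Nat.cast_ne_zero.2 (by omega)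
  have hN0 : 0 < N := by omega
  have hle : 2 * N + 2 ≤ 3 * N := by omega
  -- With no term at h^{N+1} in C, its square is c² Y² h^{2N} up to O(h^{2N+2}), one order better
  -- than the leading term alone would give.
  have hsq : ∀ {C : A⟦X⟧} {c : ℂ}, EqUpTo (N + 2) C (PowerSeries.monomial N (c • Y)) →
      EqUpTo (2 * N + 2) (fexp C) (1 + C + (c ^ 2 / 2 : ℂ) • PowerSeries.monomial (2 * N) (Y ^ 2)) :=
    fun {C c} hC => by
      have hC0 : EqUpTo N C 0 := (hC.mono (by omega)).trans (eqUpTo_monomial N _)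
      refine ((fexp_eqUpTo_quadratic hN0 hC0).mono hle).trans ((EqUpTo.refl _ _).add ?_)
      have h1 : EqUpTo (2 * N + 2) (C * C)
          (PowerSeries.monomial N (c • Y) * PowerSeries.monomial N (c • Y)) := by
        refine EqUpTo.of_sub ?_
        have ha := (hC.sub_zero.mul_zero_zero hC0).mono (show 2 * N + 2 ≤ N + 2 + N by omega)
        have hb := ((eqUpTo_monomial N (c • Y)).mul_zero_zero hC.sub_zero).mono
          (show 2 * N + 2 ≤ N + (N + 2) by omega)
        convert ha.add_zero_zero hb using 1
        noncomm_ring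
      refine (h1.smul (1 / 2)).trans ?_
      rw [PowerSeries.monomial_mul_monomial, smul_mul_smul_comm, ← two_mul, monomial_smul,
        smul_smul, ← pow_two, ← pow_two]
      refine EqUpTo.of_eq ?_
      congr 1
      ring
  have hmean : EqUpTo (N + 2) ((1 / k : ℂ) • ∑ j, B j)
      (PowerSeries.monomial N ((1 / k * ∑ j, μ j : ℂ) • Y)) := by
    refine ((EqUpTo.sum _ fun j _ => hB j).smul _).trans ?_
    rw [← map_sum, ← monomial_smul, ← Finset.sum_smul, smul_smul]
    exact EqUpTo.refl _ _
  refine ((EqUpTo.sum _ fun j _ => hsq (hB j)).smul _).trans ?_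
  refine EqUpTo.trans ?_ ((hsq hmean).symm.add (EqUpTo.refl _ _))
  refine EqUpTo.of_eq ?_
  rw [Finset.sum_add_distrib, Finset.sum_add_distrib, Finset.sum_const, Finset.card_univ,
    Fintype.card_fin, ← Finset.sum_smul, smul_add, smul_add, smul_smul, ← Nat.cast_smul_eq_nsmul ℂ,
    smul_smul, one_div_mul_cancel hk0, one_smul, monomial_smul,
    add_assoc (1 + (1 / k : ℂ) • ∑ j, B j), ← add_smul]
  congr 2
  rw [← Finset.sum_div]
  field_simp
  ring

end Averages

/-- The expansions of a family of symmetric-conjugate compositions. -/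
theorem mean_fexp_add_fexp_eqUpTo {k N : ℕ} (hk : 1 ≤ k) (hN : 2 ≤ N) (hNodd : Odd N)
    {W V : Fin k → A⟦X⟧} {μ : Fin k → ℂ} {Y : A} (hV : ∀ j, V j = -scaleSeries (-1) (W j))
    (hW : ∀ j, EqUpTo N (W j) 0) (hWN : ∀ j, PowerSeries.coeff N (W j) = μ j • Y) :
    EqUpTo (2 * N + 2) ((1 / (2 * k) : ℂ) • ∑ j, (fexp (W j) + fexp (V j)))
      (fexp ((1 / (2 * k) : ℂ) • ∑ j, (W j + V j)) + PowerSeries.monomial (2 * N)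
        ((1 / (2 * k) * (∑ j, μ j ^ 2 - 1 / k * (∑ j, μ j) ^ 2) : ℂ) • Y ^ 2)) := by
  -- The half sum of W_j and V_j is odd and N + 1 is even, so nothing occurs at h^{N+1}. The average
  -- is taken in two stages: within each pair, then over j.
  have hB : ∀ j, EqUpTo (N + 2) ((1 / 2 : ℂ) • (W j + V j))
      (PowerSeries.monomial N (μ j • Y)) := fun j i hi => by
    have hVW := eqUpTo_succ_of_odd (hV j) (hW j) hNodd
    rw [PowerSeries.coeff_smul, PowerSeries.coeff_monomial]
    rcases Nat.lt_trichotomy i N with hiN | rfl | hiN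
    · rw [if_neg hiN.ne, map_add, hVW i (by omega), hW j i hiN, map_zero, add_zero, _root_.smul_zero]
    · rw [if_pos rfl, map_add, hVW i (by omega), hWN, ← two_smul ℂ (μ j • Y), smul_smul]
      norm_num
    · rw [if_neg hiN.ne', coeff_add_eq_zero_of_even (hV j), _root_.smul_zero]
      obtain rfl : i = N + 1 := by omega
      exact hNodd.add_one
  have hc : (1 / (2 * k) : ℂ) = 1 / k * (1 / 2) := by ring
  have h1 := mean_fexp_eqUpTo hk hN hB
  rw [← Finset.smul_sum, smul_smul, ← hc] at h1
  refine EqUpTo.trans ?_ h1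
  rw [hc, ← smul_smul, Finset.smul_sum]
  exact (EqUpTo.sum _ fun j _ => half_fexp_add_fexp_eqUpTo hN (hW j)
    (eqUpTo_succ_of_odd (hV j) (hW j) hNodd)).smul _

end Conjugation

/-! ### Means of nearly equal methods -/

section Means

section Analysis

variable {E F : Type*} [NormedAddCommGroup E] [NormedSpace ℂ E]
  [NormedAddCommGroup F] [NormedSpace ℂ F] [CompleteSpace F]

/-- The second-order Taylor estimate with a varying base point. -/
theorem isBigO_sub_sub_fderiv {f : E → F} {x : E} (hf : AnalyticAt ℂ f x) :
    (fun q : E × E => f q.1 - f q.2 - fderiv ℂ f q.2 (q.1 - q.2))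
      =O[𝓝 (x, x)] fun q => ‖q.1 - q.2‖ ^ 2 := by
  obtain ⟨C, hC0, hC⟩ := hf.fderiv.hasStrictFDerivAt.isBigO_sub.exists_nonneg
  obtain ⟨ε, hε, hb⟩ := Metric.eventually_nhds_iff.1
    (hC.bound.and ((continuous_fst.tendsto (x, x)).eventually hf.eventually_analyticAt))
  refine Asymptotics.IsBigO.of_bound C (Metric.eventually_nhds_iff.2 ⟨ε, hε, fun q hq => ?_⟩)
  have h1 : q.1 ∈ Metric.ball x ε := (le_max_left _ _).trans_lt hq
  have h2 : q.2 ∈ Metric.ball x ε := (le_max_right _ _).trans_lt hq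
  have hseg : segment ℝ q.2 q.1 ⊆ Metric.ball x ε := (convex_ball x ε).segment_subset h2 h1
  have hpair : ∀ y ∈ segment ℝ q.2 q.1, dist (y, q.2) (x, x) < ε := fun y hy =>
    max_lt (hseg hy) h2
  have := Convex.norm_image_sub_le_of_norm_fderiv_le' (𝕜 := ℂ) (f := f) (φ := fderiv ℂ f q.2)
    (C := C * ‖q.1 - q.2‖) (s := segment ℝ q.2 q.1) (x := q.2) (y := q.1)
    (fun y hy => (hb (hpair y hy)).2.differentiableAt)
    (fun y hy => (hb (hpair y hy)).1.trans (by
      have := norm_sub_le_of_mem_segment hy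
      gcongr))
    (convex_segment _ _) (left_mem_segment _ _ _) (right_mem_segment _ _ _)
  refine this.trans (le_of_eq ?_)
  rw [Real.norm_of_nonneg (by positivity)]
  ring

/-- A family of maps of size `O(h ^ m)` is Lipschitz with constant `O(h ^ m)`. -/
theorem isBigO_sub_of_isBigO {z : E} {D : ℂ × E → F} (hD : AnalyticAt ℂ D (0, z)) {m : ℕ}
    (h : D =O[𝓝 (0, z)] fun p => p.1 ^ m) :
    (fun q : ℂ × E × E => D (q.1, q.2.1) - D (q.1, q.2.2))
      =O[𝓝 (0, z, z)] fun q => ‖q.1 ^ m‖ * ‖q.2.1 - q.2.2‖ := by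
  obtain ⟨C, hC⟩ := (isBigO_fderiv hD h).bound
  obtain ⟨ε, hε, hb⟩ := exists_ball_prod (hC.and hD.eventually_analyticAt)
  refine Asymptotics.IsBigO.of_bound C (Metric.eventually_nhds_iff.2 ⟨ε, hε, fun q hq => ?_⟩)
  have ht : ‖q.1‖ < ε := by
    have : dist q.1 0 < ε := (le_max_left _ _).trans_lt hq
    rwa [dist_zero_right] at this
  have hq' : max (dist q.2.1 z) (dist q.2.2 z) < ε := (le_max_right _ _).trans_lt hq
  have h1 : q.2.1 ∈ Metric.ball z ε := (le_max_left _ _).trans_lt hq'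
  have h2 : q.2.2 ∈ Metric.ball z ε := (le_max_right _ _).trans_lt hq'
  have hw : ∀ w ∈ Metric.ball z ε, ‖w - z‖ < ε := fun w hw => by
    rwa [Metric.mem_ball, dist_eq_norm] at hw
  have := Convex.norm_image_sub_le_of_norm_fderiv_le (𝕜 := ℂ) (f := fun w => D (q.1, w))
    (C := C * ‖q.1 ^ m‖) (s := Metric.ball z ε) (x := q.2.2) (y := q.2.1)
    (fun w hw' => (AnalyticAt.fun_comp (f := fun w : E => (q.1, w)) (hb q.1 w ht (hw w hw')).2
      (by fun_prop)).differentiableAt)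
    (fun w hw' => (hb q.1 w ht (hw w hw')).1) (convex_ball z ε) h2 h1
  refine this.trans (le_of_eq ?_)
  rw [Real.norm_of_nonneg (by positivity), mul_assoc]

end Analysis

variable {d : ℕ} {U : TopologicalSpace.Opens (Fin d → ℂ)}

/-- The joint map `(h, z) ↦ M_h(z)`. -/
def Integrator.joint (M : Integrator U) (p : ℂ × (Fin d → ℂ)) : Fin d → ℂ := M.toFun p.1 p.2

theorem taylorCoeff_sub {a b : ℂ → ℂ} (ha : AnalyticAt ℂ a 0) (hb : AnalyticAt ℂ b 0) (i : ℕ) :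
    taylorCoeff i (fun t => a t - b t) = taylorCoeff i a - taylorCoeff i b := by
  rw [taylorCoeff, iteratedDeriv_fun_sub ha.contDiffAt hb.contDiffAt, mul_sub]
  rfl

/-- The coordinate functions. -/
def coordFun (U : TopologicalSpace.Opens (Fin d → ℂ)) (c : Fin d) : HolFun U :=
  ⟨(U : Set (Fin d → ℂ)).indicator fun z => z c, indicator_mem_holFun fun z _ =>
    (ContinuousLinearMap.proj (R := ℂ) (φ := fun _ : Fin d => ℂ) c).analyticAt z⟩

theorem coordFun_apply (c : Fin d) {z : Fin d → ℂ} (hz : z ∈ U) : (coordFun U c).1 z = z c := by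
  have hz' : z ∈ (U : Set (Fin d → ℂ)) := hz
  simp [coordFun, hz']

theorem Integrator.analyticAt_coord (M : Integrator U) {z : Fin d → ℂ} (hz : z ∈ U) (c : Fin d) :
    AnalyticAt ℂ (fun p => M.joint p c) (0, z) :=
  ((ContinuousLinearMap.proj (R := ℂ) (φ := fun _ : Fin d => ℂ) c).analyticAt _).fun_comp
    (M.analytic z hz)

theorem Integrator.analyticAt_coord_time (M : Integrator U) {z : Fin d → ℂ} (hz : z ∈ U)
    (c : Fin d) : AnalyticAt ℂ (fun t => M.toFun t z c) 0 :=
  AnalyticAt.fun_comp (f := fun h : ℂ => (h, z)) (M.analyticAt_coord hz c) (by fun_prop)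

theorem Integrator.taylorCoeff_coord (M : Integrator U) {z : Fin d → ℂ} (hz : z ∈ U) (c : Fin d)
    (i : ℕ) : taylorCoeff i (fun t => M.toFun t z c) = (M.opCoeff i (coordFun U c)).1 z := by
  rw [M.opCoeff_apply _ _ hz]
  refine taylorCoeff_congr ?_ i
  filter_upwards [(M.tendsto_time hz).eventually (U.isOpen.mem_nhds hz)] with t ht
  exact (coordFun_apply c ht).symm

theorem taylorCoeff_coord_sub {M N : Integrator U} {i : ℕ}
    (h : PowerSeries.coeff i M.opSeries = PowerSeries.coeff i N.opSeries) {z : Fin d → ℂ}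
    (hz : z ∈ U) (c : Fin d) :
    taylorCoeff i (fun t => M.joint (t, z) c - N.joint (t, z) c) = 0 := by
  rw [M.coeff_opSeries, N.coeff_opSeries] at h
  refine (taylorCoeff_sub (M.analyticAt_coord_time hz c) (N.analyticAt_coord_time hz c) i).trans ?_
  rw [M.taylorCoeff_coord hz, N.taylorCoeff_coord hz, h, sub_self]

/-- Methods with the same series up to `O(h ^ m)` agree up to `O(h ^ m)`. -/
theorem isBigO_joint_sub {M N : Integrator U} {m : ℕ} (h : EqUpTo m M.opSeries N.opSeries)
    {z : Fin d → ℂ} (hz : z ∈ U) :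
    (fun p => M.joint p - N.joint p) =O[𝓝 (0, z)] fun p => p.1 ^ m := by
  refine Asymptotics.isBigO_pi.2 fun c => ?_
  refine isBigO_of_taylorCoeff_eq_zero ((M.analyticAt_coord hz c).sub (N.analyticAt_coord hz c)) ?_
  filter_upwards [U.isOpen.mem_nhds hz] with w hw i hi
  exact taylorCoeff_coord_sub (h i hi) hw c

/-- Methods with the same series are equal for small step sizes. -/
theorem eventually_joint_eq {M N : Integrator U} (h : M.opSeries = N.opSeries)
    {z : Fin d → ℂ} (hz : z ∈ U) : ∀ᶠ p in 𝓝 (0, z), M.joint p = N.joint p := by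
  have : ∀ c, ∀ᶠ p in 𝓝 ((0 : ℂ), z), M.joint p c - N.joint p c = 0 := fun c => by
    refine eventually_eq_zero_of_taylorCoeff_prod
      ((M.analyticAt_coord hz c).sub (N.analyticAt_coord hz c)) ?_
    filter_upwards [U.isOpen.mem_nhds hz] with w hw i
    exact taylorCoeff_coord_sub (by rw [h]) hw c
  filter_upwards [eventually_all.2 this] with p hp
  exact funext fun c => sub_eq_zero.1 (hp c)

variable {ι : Type*} [Fintype ι]

/-- The weighted sum `c ∑ᵢ Mᵢ` of maps. -/
def weightedSum (c : ℂ) (M : ι → Integrator U) (p : ℂ × (Fin d → ℂ)) : Fin d → ℂ :=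
  c • ∑ i, (M i).joint p

theorem analyticAt_weightedSum (c : ℂ) (M : ι → Integrator U) {z : Fin d → ℂ} (hz : z ∈ U) :
    AnalyticAt ℂ (weightedSum c M) (0, z) :=
  AnalyticAt.fun_smul (f := fun _ => c) analyticAt_const (Finset.univ.analyticAt_fun_sum fun i _ => (M i).analytic z hz)

theorem sub_weightedSum {c : ℂ} (hc : c * Fintype.card ι = 1) (M : ι → Integrator U) (i : ι)
    (p : ℂ × (Fin d → ℂ)) :
    (M i).joint p - weightedSum c M p = c • ∑ l, ((M i).joint p - (M l).joint p) := by
  rw [weightedSum, Finset.sum_sub_distrib, Finset.sum_const, Finset.card_univ, smul_sub,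
    ← Nat.cast_smul_eq_nsmul ℂ, smul_smul, hc, one_smul]

/-- The deviation from the mean is c times the sum of the pairwise differences. -/
theorem isBigO_sub_weightedSum {c : ℂ} (hc : c * Fintype.card ι = 1) {M : ι → Integrator U}
    {m : ℕ} (hM : ∀ i l, EqUpTo m (M i).opSeries (M l).opSeries) {z : Fin d → ℂ} (hz : z ∈ U)
    (i : ι) :
    (fun p => (M i).joint p - weightedSum c M p) =O[𝓝 (0, z)] fun p => p.1 ^ m := by
  simp only [sub_weightedSum hc]
  exact (Asymptotics.IsBigO.fun_sum fun l _ => isBigO_joint_sub (hM i l) hz).const_smul_left c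

theorem sum_sub_weightedSum {c : ℂ} (hc : c * Fintype.card ι = 1) (M : ι → Integrator U)
    (p : ℂ × (Fin d → ℂ)) : ∑ i, ((M i).joint p - weightedSum c M p) = 0 := by
  rw [Finset.sum_sub_distrib, Finset.sum_const, Finset.card_univ, weightedSum,
    ← Nat.cast_smul_eq_nsmul ℂ, smul_smul, mul_comm, hc, one_smul, sub_self]

/-- The mean of methods that agree up to `O(h ^ m)` and are adjoint to each other in pairs is
pseudo-symmetric of order `2 m - 1`. -/
theorem isPseudoSymmetric_weightedSum {c : ℂ} (hc : c * Fintype.card ι = 1)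
    {M : ι → Integrator U} {m q : ℕ} (hq : q + 1 = 2 * m)
    (hM : ∀ i l, EqUpTo m (M i).opSeries (M l).opSeries) (τ : ι ≃ ι)
    (hτ : ∀ i, scaleSeries (-1) (M (τ i)).opSeries * (M i).opSeries = 1) :
    IsPseudoSymmetric U (fun h z => weightedSum c M (h, z)) q := by
  intro z hz
  set φ := weightedSum c M
  have hφ : AnalyticAt ℂ φ (0, z) := analyticAt_weightedSum c M hz
  have hφ0 : φ (0, z) = z := by
    have : ∀ i, (M i).joint (0, z) = z := fun i => (M i).map_zero z hz
    simp only [φ, weightedSum, this, Finset.sum_const, Finset.card_univ]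
    rw [← Nat.cast_smul_eq_nsmul ℂ, smul_smul, hc, one_smul]
  have hneg : Tendsto (fun h : ℝ => (-(h : ℂ), z)) (𝓝 0) (𝓝 (0, z)) :=
    Continuous.tendsto' (by fun_prop) _ _ (by simp)
  have hcast : Tendsto (fun h : ℝ => (h : ℂ)) (𝓝 0) (𝓝 0) :=
    Complex.continuous_ofReal.tendsto' _ _ (by simp)
  have ha : Tendsto (fun h : ℝ => φ (-(h : ℂ), z)) (𝓝 0) (𝓝 z) := by
    have := hφ.continuousAt.tendsto.comp hneg
    rwa [hφ0] at this
  have hb : ∀ i, Tendsto (fun h : ℝ => (M i).joint (-(h : ℂ), z)) (𝓝 0) (𝓝 z) := fun i =>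
    ((M i).tendsto_prod hz).comp hneg
  have hDz : ∀ i, (fun h : ℝ => (M i).joint (-(h : ℂ), z) - φ (-(h : ℂ), z))
      =O[𝓝 0] fun h : ℝ => h ^ m := fun i =>
    ((isBigO_sub_weightedSum hc hM hz i).comp_tendsto hneg).trans
      (Asymptotics.IsBigO.of_bound 1 (by simp))
  have hpow : (fun h : ℝ => ‖(h : ℂ) ^ m‖) =O[𝓝 0] fun h : ℝ => h ^ m :=
    Asymptotics.IsBigO.of_bound 1 (by simp)
  -- An identity of operator series is an exact identity of maps for small steps, by analyticity.
  have hinv : ∀ i, ∀ᶠ h : ℝ in 𝓝 0, (M i).joint (h, (M (τ i)).joint (-(h : ℂ), z)) = z :=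
    fun i => by
      have hser : ((M i).comp ((M (τ i)).scale (-1))).opSeries = (Integrator.one U).opSeries := by
        rw [Integrator.opSeries_comp, Integrator.opSeries_scale, Integrator.opSeries_one]
        exact hτ i
      have ht : Tendsto (fun h : ℝ => ((h : ℂ), z)) (𝓝 0) (𝓝 (0, z)) :=
        hcast.prodMk_nhds tendsto_const_nhds
      filter_upwards [ht.eventually (eventually_joint_eq hser hz)] with h hh
      simpa [Integrator.joint, Integrator.comp, Integrator.scale, Integrator.one] using hh
  -- M_i - φ has Lipschitz constant O(h^m), and the points φ(-h, z) and M_{τ i}(-h, z) are O(h^m)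
  -- apart.
  have h1 : ∀ i, (fun h : ℝ =>
      ((M i).joint (h, φ (-(h : ℂ), z)) - φ (h, φ (-(h : ℂ), z)))
        - ((M i).joint (h, (M (τ i)).joint (-(h : ℂ), z))
          - φ (h, (M (τ i)).joint (-(h : ℂ), z))))
      =O[𝓝 0] fun h : ℝ => h ^ (q + 1) := fun i => by
    have hD := isBigO_sub_of_isBigO (((M i).analytic z hz).sub hφ)
      (isBigO_sub_weightedSum hc hM hz i)
    have ht : Tendsto (fun h : ℝ => ((h : ℂ), φ (-(h : ℂ), z), (M (τ i)).joint (-(h : ℂ), z)))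
        (𝓝 0) (𝓝 (0, z, z)) := hcast.prodMk_nhds (ha.prodMk_nhds (hb _))
    refine (hD.comp_tendsto ht).trans ?_
    rw [hq, two_mul]
    simp only [pow_add]
    refine hpow.mul ?_
    refine Asymptotics.IsBigO.norm_left ?_
    exact ((hDz (τ i)).neg_left).congr_left fun h => by simp
  -- Linearization of φ(h, ·) at φ(-h, z); the error is quadratic in a distance O(h^m).
  have h2 : ∀ i, (fun h : ℝ => φ (h, (M (τ i)).joint (-(h : ℂ), z)) - φ (h, φ (-(h : ℂ), z))
      - fderiv ℂ φ (h, φ (-(h : ℂ), z))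
        (0, (M (τ i)).joint (-(h : ℂ), z) - φ (-(h : ℂ), z)))
      =O[𝓝 0] fun h : ℝ => h ^ (q + 1) := fun i => by
    have ht : Tendsto (fun h : ℝ => (((h : ℂ), (M (τ i)).joint (-(h : ℂ), z)),
        ((h : ℂ), φ (-(h : ℂ), z)))) (𝓝 0) (𝓝 ((0, z), (0, z))) :=
      (hcast.prodMk_nhds (hb _)).prodMk_nhds (hcast.prodMk_nhds ha)
    refine (((isBigO_sub_sub_fderiv hφ).comp_tendsto ht).congr_left fun h => ?_).trans ?_
    · simp only [Function.comp_apply, Prod.mk_sub_mk, sub_self]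
    · have := (hDz (τ i)).norm_left.pow 2
      refine (this.congr_left fun h => ?_).congr_right fun h => ?_
      · simp [Prod.norm_def]
      · rw [hq, mul_comm, pow_mul]
  -- The linear terms cancel because τ permutes the deviations, whose sum is zero. This cancellation
  -- doubles the order.
  have hsum : ∀ h : ℝ, ∑ i, fderiv ℂ φ (h, φ (-(h : ℂ), z))
      (0, (M (τ i)).joint (-(h : ℂ), z) - φ (-(h : ℂ), z)) = 0 := fun h => by
    have hpair : ∀ v : ι → Fin d → ℂ, ∑ i, ((0 : ℂ), v i) = (0, ∑ i, v i) := fun v => by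
      ext <;> simp [Prod.fst_sum, Prod.snd_sum]
    rw [← map_sum, hpair, Equiv.sum_comp τ fun i =>
      (M i).joint (-(h : ℂ), z) - φ (-(h : ℂ), z), sum_sub_weightedSum hc M]
    exact map_zero _
  have key := (Asymptotics.IsBigO.fun_sum (s := Finset.univ) fun i _ =>
    (h1 i).sub (h2 i)).const_smul_left c
  refine key.congr' ?_ EventuallyEq.rfl
  filter_upwards [eventually_all.2 hinv] with h hh
  have hterm : ∀ i, (M i).joint (h, φ (-(h : ℂ), z)) - φ (h, φ (-(h : ℂ), z))
        - ((M i).joint (h, (M (τ i)).joint (-(h : ℂ), z))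
          - φ (h, (M (τ i)).joint (-(h : ℂ), z)))
        - (φ (h, (M (τ i)).joint (-(h : ℂ), z)) - φ (h, φ (-(h : ℂ), z))
          - fderiv ℂ φ (h, φ (-(h : ℂ), z))
            (0, (M (τ i)).joint (-(h : ℂ), z) - φ (-(h : ℂ), z)))
      = (M i).joint (h, φ (-(h : ℂ), z)) - z + fderiv ℂ φ (h, φ (-(h : ℂ), z))
            (0, (M (τ i)).joint (-(h : ℂ), z) - φ (-(h : ℂ), z)) := fun i => by
    rw [hh i]
    abel
  simp only [Pi.smul_apply, hterm]
  rw [Finset.sum_add_distrib, hsum, add_zero, Finset.sum_sub_distrib, smul_sub, Finset.sum_const,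
    Finset.card_univ, ← Nat.cast_smul_eq_nsmul ℂ, smul_smul, hc, one_smul]
  rfl

end Means

/-! ### Symplecticity -/

section Symplectic

variable {d : ℕ} {U : TopologicalSpace.Opens (Fin d → ℂ)}

theorem jacobian_apply (M : ℂ → (Fin d → ℂ) → (Fin d → ℂ)) (h : ℂ) (z : Fin d → ℂ) (i j : Fin d) :
    jacobian M h z i j = fderiv ℂ (M h) z (Pi.single j 1) i := by
  rw [jacobian, LinearMap.toMatrix'_apply]
  rfl

theorem Integrator.eventually_analyticAt (M : Integrator U) {z : Fin d → ℂ} (hz : z ∈ U) :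
    ∀ᶠ p in 𝓝 ((0 : ℂ), z), AnalyticAt ℂ (M.toFun p.1) p.2 := by
  filter_upwards [(M.analytic z hz).eventually_analyticAt] with p hp
  exact AnalyticAt.fun_comp (f := fun w => (p.1, w)) (x := p.2) hp (by fun_prop)

/-- `M` preserves the form `J` for all step sizes near `0` and all arguments near a point of `U`. -/
def IsLocallySymplectic (U : TopologicalSpace.Opens (Fin d → ℂ)) (J : Matrix (Fin d) (Fin d) ℂ)
    (M : ℂ → (Fin d → ℂ) → (Fin d → ℂ)) : Prop :=
  ∀ z ∈ U, ∀ᶠ p in 𝓝 ((0 : ℂ), z), (jacobian M p.1 p.2)ᵀ * J * jacobian M p.1 p.2 = J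

theorem Integrator.analyticAt_jacobian (M : Integrator U) {z : Fin d → ℂ} (hz : z ∈ U)
    (i j : Fin d) : AnalyticAt ℂ (fun p => jacobian M.toFun p.1 p.2 i j) (0, z) := by
  have h1 : AnalyticAt ℂ (fun p => fderiv ℂ M.joint p ((0 : ℂ), Pi.single j (1 : ℂ)) i) (0, z) :=
    ((ContinuousLinearMap.proj (R := ℂ) (φ := fun _ : Fin d => ℂ) i).analyticAt _).fun_comp
      (((ContinuousLinearMap.apply ℂ (Fin d → ℂ) ((0 : ℂ), Pi.single j (1 : ℂ))).analyticAt
        _).fun_comp (M.analytic z hz).fderiv)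
  refine h1.congr ?_
  filter_upwards [(M.analytic z hz).eventually_analyticAt] with p hp
  have h2 : HasFDerivAt (fun w => (p.1, w)) (ContinuousLinearMap.inr ℂ ℂ (Fin d → ℂ)) p.2 :=
    hasFDerivAt_prodMk_right p.1 p.2
  have h3 : HasFDerivAt M.joint (fderiv ℂ M.joint p) (p.1, p.2) :=
    hp.differentiableAt.hasFDerivAt
  have h4 := (h3.comp p.2 h2).fderiv
  rw [jacobian_apply]
  exact (congrArg (fun L : (Fin d → ℂ) →L[ℂ] (Fin d → ℂ) => L (Pi.single j 1) i) h4).symm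

theorem Integrator.analyticAt_form (M : Integrator U) (J : Matrix (Fin d) (Fin d) ℂ)
    {z : Fin d → ℂ} (hz : z ∈ U) (i j : Fin d) :
    AnalyticAt ℂ (fun p => ((jacobian M.toFun p.1 p.2)ᵀ * J * jacobian M.toFun p.1 p.2) i j)
      (0, z) := by
  simp only [Matrix.mul_apply, Matrix.transpose_apply]
  exact Finset.univ.analyticAt_fun_sum fun l _ => AnalyticAt.fun_mul
    (Finset.univ.analyticAt_fun_sum fun r _ =>
      (M.analyticAt_jacobian hz r i).fun_mul analyticAt_const) (M.analyticAt_jacobian hz l j)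

/-- Symplecticity for small real step sizes extends to complex step sizes. -/
theorem IsSymplectic.isLocallySymplectic {J : Matrix (Fin d) (Fin d) ℝ} {M : Integrator U}
    (h : IsSymplectic U J M.toFun) :
    IsLocallySymplectic U (J.map fun x : ℝ => (x : ℂ)) M.toFun := by
  intro z hz
  set J' := J.map fun x : ℝ => (x : ℂ)
  have key : ∀ i j, ∀ᶠ p in 𝓝 ((0 : ℂ), z),
      ((jacobian M.toFun p.1 p.2)ᵀ * J' * jacobian M.toFun p.1 p.2) i j - J' i j = 0 :=
    fun i j => by
      -- At each fixed w near z the defect vanishes for small real steps, hence has zero Taylor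
      -- coefficients. Complex steps matter because the composition coefficients are complex.
      refine eventually_eq_zero_of_taylorCoeff_prod
        ((M.analyticAt_form J' hz i j).fun_sub analyticAt_const) ?_
      filter_upwards [U.isOpen.mem_nhds hz] with w hw l
      have han : AnalyticAt ℂ (fun t : ℂ =>
          ((jacobian M.toFun t w)ᵀ * J' * jacobian M.toFun t w) i j - J' i j) 0 :=
        AnalyticAt.fun_comp (f := fun t : ℂ => (t, w))
          ((M.analyticAt_form J' hw i j).fun_sub analyticAt_const) (by fun_prop)
      refine (taylorCoeff_eq_of_eventually_real (b := fun _ => 0) han analyticAt_const ?_ l).trans ?_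
      · filter_upwards [h w hw] with t ht
        rw [ht, sub_self]
      · simp [taylorCoeff]
  filter_upwards [eventually_all.2 fun i => eventually_all.2 (key i)] with p hp
  ext i j
  exact sub_eq_zero.1 (hp i j)

theorem isLocallySymplectic_one (J : Matrix (Fin d) (Fin d) ℂ) :
    IsLocallySymplectic U J (Integrator.one U).toFun := fun z _ => Eventually.of_forall fun p => by
  have : jacobian (Integrator.one U).toFun p.1 p.2 = 1 := by
    have h : fderiv ℂ ((Integrator.one U).toFun p.1) p.2 = ContinuousLinearMap.id ℂ _ := fderiv_id
    rw [jacobian, h]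
    exact LinearMap.toMatrix'_id
  rw [this]
  simp

theorem IsLocallySymplectic.scale {J : Matrix (Fin d) (Fin d) ℂ} {M : Integrator U}
    (h : IsLocallySymplectic U J M.toFun) (a : ℂ) :
    IsLocallySymplectic U J (M.scale a).toFun := fun z hz => by
  have ht : Tendsto (fun p : ℂ × (Fin d → ℂ) => (a * p.1, p.2)) (𝓝 (0, z)) (𝓝 (0, z)) :=
    Continuous.tendsto' (by fun_prop) _ _ (by simp)
  exact ht.eventually (h z hz)

theorem IsLocallySymplectic.comp {J : Matrix (Fin d) (Fin d) ℂ} {M N : Integrator U}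
    (hM : IsLocallySymplectic U J M.toFun) (hN : IsLocallySymplectic U J N.toFun) :
    IsLocallySymplectic U J (M.comp N).toFun := fun z hz => by
  -- In the chain rule M is differentiated at the moved point N_h(z), so symplecticity is needed on
  -- a neighbourhood of z.
  have ht : Tendsto (fun p : ℂ × (Fin d → ℂ) => (p.1, N.toFun p.1 p.2)) (𝓝 (0, z)) (𝓝 (0, z)) :=
    (continuous_fst.tendsto' _ _ rfl).prodMk_nhds (N.tendsto_prod hz)
  filter_upwards [ht.eventually (hM z hz), hN z hz, ht.eventually (M.eventually_analyticAt hz),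
    N.eventually_analyticAt hz] with p h1 h2 h3 h4
  have hcomp : jacobian (M.comp N).toFun p.1 p.2
      = jacobian M.toFun p.1 (N.toFun p.1 p.2) * jacobian N.toFun p.1 p.2 := by
    have := fderiv_comp p.2 h3.differentiableAt h4.differentiableAt
    rw [jacobian, jacobian, jacobian, ← LinearMap.toMatrix'_comp]
    exact congrArg (fun L : (Fin d → ℂ) →L[ℂ] (Fin d → ℂ) =>
      LinearMap.toMatrix' (L : (Fin d → ℂ) →ₗ[ℂ] (Fin d → ℂ))) this
  rw [hcomp, Matrix.transpose_mul]
  calc _ = (jacobian N.toFun p.1 p.2)ᵀ * ((jacobian M.toFun p.1 (N.toFun p.1 p.2))ᵀ * J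
        * jacobian M.toFun p.1 (N.toFun p.1 p.2)) * jacobian N.toFun p.1 p.2 := by
        simp only [Matrix.mul_assoc]
    _ = J := by rw [h1, h2]

theorem IsLocallySymplectic.compList {J : Matrix (Fin d) (Fin d) ℂ} {S : Integrator U}
    (h : IsLocallySymplectic U J S.toFun) (l : List ℂ) :
    IsLocallySymplectic U J (S.compList l).toFun := by
  induction l with
  | nil => exact isLocallySymplectic_one J
  | cons a l ih => exact (h.scale a).comp ih

/-- Equal series give equal maps near (0, z), hence equal Jacobians. This serves the conjugate
method, which shares its series with the reversed composition. -/
theorem IsLocallySymplectic.congr {J : Matrix (Fin d) (Fin d) ℂ} {M N : Integrator U}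
    (hM : IsLocallySymplectic U J M.toFun) (h : M.opSeries = N.opSeries) :
    IsLocallySymplectic U J N.toFun := fun z hz => by
  filter_upwards [hM z hz, (eventually_joint_eq h hz).eventually_nhds] with p h1 h2
  have h3 : M.toFun p.1 =ᶠ[𝓝 p.2] N.toFun p.1 :=
    (Continuous.tendsto (f := fun w => (p.1, w)) (by fun_prop) p.2).eventually h2
  have : jacobian N.toFun p.1 p.2 = jacobian M.toFun p.1 p.2 := by
    rw [jacobian, jacobian, h3.fderiv_eq]
  rw [this, h1]

variable {ι : Type*} [Fintype ι]

/-- The mean of symplectic methods that agree up to `O(h ^ m)` is pseudo-symplectic of order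
`2 m - 1`. -/
theorem isPseudoSymplectic_weightedSum {c : ℂ} (hc : c * Fintype.card ι = 1)
    {M : ι → Integrator U} {m q : ℕ} (hq : q + 1 = 2 * m)
    (hM : ∀ i l, EqUpTo m (M i).opSeries (M l).opSeries) {J : Matrix (Fin d) (Fin d) ℝ}
    (hJ : ∀ i, IsLocallySymplectic U (J.map fun x : ℝ => (x : ℂ)) (M i).toFun) :
    IsPseudoSymplectic U J (fun h z => weightedSum c M (h, z)) q := by
  intro z hz a b
  set J' := J.map fun x : ℝ => (x : ℂ)
  set φ : ℂ → (Fin d → ℂ) → (Fin d → ℂ) := fun h z => weightedSum c M (h, z)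
  have ht : Tendsto (fun h : ℝ => ((h : ℂ), z)) (𝓝 0) (𝓝 (0, z)) :=
    Continuous.tendsto' (by fun_prop) _ _ (by simp)
  set D : ι → ℝ → Matrix (Fin d) (Fin d) ℂ := fun i h =>
    jacobian (M i).toFun h z - jacobian φ h z with hD
  have hφan := analyticAt_weightedSum c M hz
  have hφ : ∀ᶠ h : ℝ in 𝓝 0, DifferentiableAt ℂ (φ h) z := by
    filter_upwards [ht.eventually hφan.eventually_analyticAt] with h hh
    exact (AnalyticAt.fun_comp (f := fun w => ((h : ℂ), w)) (x := z) hh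
      (by fun_prop)).differentiableAt
  have hMd : ∀ᶠ h : ℝ in 𝓝 0, ∀ i, DifferentiableAt ℂ ((M i).toFun h) z :=
    eventually_all.2 fun i => (ht.eventually ((M i).eventually_analyticAt hz)).mono
      fun h hh => hh.differentiableAt
  -- Cauchy's estimate passes the bound O(h^m) from the deviation of the maps to that of the
  -- Jacobians.
  have hDO : ∀ i r s, (fun h => D i h r s) =O[𝓝 0] fun h : ℝ => h ^ m := fun i r s => by
    have h1 := (isBigO_fderiv (((M i).analytic z hz).sub hφan)
      (isBigO_sub_weightedSum hc hM hz i)).comp_tendsto ht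
    refine Asymptotics.IsBigO.trans ?_ (h1.trans (Asymptotics.IsBigO.of_bound 1 (by simp)))
    refine Asymptotics.IsBigO.of_bound 1 ?_
    filter_upwards [hφ, hMd] with h h2 h3
    have h4 : D i h r s = fderiv ℂ (fun w => (M i).toFun h w - φ h w) z (Pi.single s 1) r := by
      rw [fderiv_fun_sub (h3 i) h2, hD]
      simp only [Matrix.sub_apply, jacobian_apply]
      rfl
    rw [h4]
    refine (norm_le_pi_norm _ r).trans ((ContinuousLinearMap.le_opNorm _ _).trans ?_)
    rw [one_mul, Pi.norm_single, norm_one, mul_one]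
    exact le_rfl
  have hsum : ∀ᶠ h : ℝ in 𝓝 0, ∑ i, D i h = 0 := by
    filter_upwards [hφ, hMd] with h h2 h3
    have h4 : jacobian φ h z = c • ∑ i, jacobian (M i).toFun h z := by
      have h5 : HasFDerivAt (φ h) (c • ∑ i, fderiv ℂ ((M i).toFun h) z) z :=
        (HasFDerivAt.fun_sum fun i _ => (h3 i).hasFDerivAt).const_smul c
      ext r s
      simp [jacobian_apply, h5.fderiv, Matrix.sum_apply]
    rw [hD]
    simp only
    rw [Finset.sum_sub_distrib, Finset.sum_const, Finset.card_univ, h4,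
      ← Nat.cast_smul_eq_nsmul ℂ, smul_smul, mul_comm, hc, one_smul, sub_self]
  have hO : (fun h : ℝ => -(c • ∑ i, ((D i h)ᵀ * J' * D i h) a b)) =O[𝓝 0]
      fun h : ℝ => h ^ (q + 1) := by
    refine ((Asymptotics.IsBigO.fun_sum fun i _ => ?_).const_smul_left c).neg_left
    simp only [Matrix.mul_apply, Matrix.transpose_apply]
    refine Asymptotics.IsBigO.fun_sum fun r _ => ?_
    rw [hq, two_mul]
    simp only [pow_add]
    refine Asymptotics.IsBigO.mul (Asymptotics.IsBigO.fun_sum fun s _ => ?_) (hDO i r b)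
    simp only [mul_comm _ (J' s r)]
    exact (hDO i s a).const_mul_left _
  refine hO.congr' ?_ EventuallyEq.rfl
  filter_upwards [hsum, eventually_all.2 fun i => ht.eventually (hJ i z hz)] with h hs hsym
  obtain ⟨Z, hZ⟩ : ∃ Z, Z = (jacobian φ h z)ᵀ * J' * jacobian φ h z := ⟨_, rfl⟩
  -- Expansion of the symplecticity of M_i around the mean Jacobian. After averaging, the terms
  -- linear in D_i vanish and only the quadratic ones, O(h^{2m}), remain.
  have hX : ∀ i, J' = Z + (D i h)ᵀ * (J' * jacobian φ h z)
      + (jacobian φ h z)ᵀ * J' * D i h + (D i h)ᵀ * J' * D i h := fun i => by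
    have h1 : jacobian (M i).toFun h z = jacobian φ h z + D i h := by simp [hD]
    conv_lhs => rw [← hsym i, h1]
    rw [hZ]
    rw [Matrix.transpose_add]
    noncomm_ring
  have hXsum := congrArg (fun T => c • T) (Finset.sum_congr rfl fun i (_ : i ∈ Finset.univ) => hX i)
  simp only [Finset.sum_add_distrib, ← Finset.sum_mul, ← Finset.mul_sum,
    ← Matrix.transpose_sum, hs, Matrix.transpose_zero, Matrix.zero_mul, Matrix.mul_zero,
    add_zero, Finset.sum_const, Finset.card_univ, smul_add] at hXsum
  rw [← Nat.cast_smul_eq_nsmul ℂ, ← Nat.cast_smul_eq_nsmul ℂ, smul_smul, smul_smul, hc,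
    one_smul, one_smul] at hXsum
  have := congrArg (fun T : Matrix (Fin d) (Fin d) ℂ => T a b) hXsum
  simp only [Matrix.add_apply, Matrix.smul_apply, Matrix.sum_apply] at this
  rw [← hZ, Matrix.sub_apply, this]
  ring

end Symplectic

/-! ### Linear combinations of symmetric-conjugate compositions -/

section Main

variable {d : ℕ} {U : TopologicalSpace.Opens (Fin d → ℂ)}

theorem conjFun_conjFun (hU : ∀ z ∈ U, star z ∈ U) (g : HolFun U) :
    conjFun hU (conjFun hU g) = g := by
  ext z
  simp [conjFun]

/-- Complex conjugation of operators as a ring homomorphism. -/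
def conjOpHom (hU : ∀ z ∈ U, star z ∈ U) : Op U →+* Op U where
  toFun := conjOp hU
  map_one' := op_ext fun g z _ => congrArg (fun g : HolFun U => g.1 z) (conjFun_conjFun hU g)
  map_mul' D D' := op_ext fun g z _ => by
    change (conjFun hU (D (D' (conjFun hU g)))).1 z
      = (conjFun hU (D (conjFun hU (conjFun hU (D' (conjFun hU g)))))).1 z
    rw [conjFun_conjFun]
  map_zero' := op_ext fun g z _ => by
    change star (0 : ℂ) = 0
    exact star_zero ℂ
  map_add' D D' := op_ext fun g z _ => by
    change star ((D (conjFun hU g)).1 (star z) + (D' (conjFun hU g)).1 (star z)) = _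
    exact star_add _ _

theorem conjOpHom_smul (hU : ∀ z ∈ U, star z ∈ U) (c : ℂ) (D : Op U) :
    conjOpHom hU (c • D) = star c • conjOpHom hU D := op_ext fun g z _ => by
  change star (c * (D (conjFun hU g)).1 (star z)) = star c * star ((D (conjFun hU g)).1 (star z))
  rw [star_mul']

theorem conjSeries_eq_map (hU : ∀ z ∈ U, star z ∈ U) (P : (Op U)⟦X⟧) :
    conjSeries hU P = PowerSeries.map (conjOpHom hU) P := by
  ext1 m
  rw [conjSeries, PowerSeries.coeff_mk]
  rfl

theorem opSeries_compList (S : Integrator U) (l : List ℂ) :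
    (S.compList l).opSeries = compSeries S.opSeries l := by
  induction l with
  | nil => exact Integrator.opSeries_one
  | cons a l ih =>
    refine (Integrator.opSeries_comp (S.scale a) (S.compList l)).trans ?_
    rw [ih, Integrator.opSeries_scale]
    rfl

/-- For a real method, conjugating a composition conjugates its coefficients, and here that amounts
to reversing them. -/
theorem opSeries_conj_compList (hU : ∀ z ∈ U, star z ∈ U) {S : Integrator U}
    (hS : IsRealMethod U S.toFun) {l : List ℂ} (hl : l.map star = l.reverse) :
    ((S.compList l).conj hU).opSeries = compSeries S.opSeries l.reverse := by
  have hP := Integrator.conjSeries_opSeries hU hS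
  rw [conjSeries_eq_map] at hP
  rw [Integrator.opSeries_conj, conjSeries_eq_map, opSeries_compList, ← hl]
  exact map_compSeries (A := Op U) (σ := conjOpHom hU) (conjOpHom_smul hU) (P := S.opSeries) hP l

/-- The compositions and their conjugates enter on an equal footing, as 2k methods of equal weight.
-/
theorem linComb_eq_weightedSum {k : ℕ} (hU : ∀ z ∈ U, star z ∈ U) (ψ : Fin k → Integrator U) :
    linComb hU ψ = fun h z => weightedSum (1 / (2 * k) : ℂ)
      (Sum.elim ψ fun j => (ψ j).conj hU) (h, z) := by
  funext h z
  rw [linComb, weightedSum, Fintype.sum_sum_type, Finset.sum_add_distrib]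
  rfl

/-- The case k = 1, so that one argument treats both φ and its single terms. -/
theorem reMethod_eq_linComb (hU : ∀ z ∈ U, star z ∈ U) (ψ : Integrator U) :
    reMethod hU ψ = linComb hU fun _ : Fin 1 => ψ := by
  funext h z
  simp [reMethod, linComb]

theorem taylorCoeff_smul_sum {ι : Type*} [Fintype ι] (c : ℂ) {a : ι → ℂ → ℂ}
    (ha : ∀ i, AnalyticAt ℂ (a i) 0) (m : ℕ) :
    taylorCoeff m (fun t => c * ∑ i, a i t) = c * ∑ i, taylorCoeff m (a i) := by
  rw [taylorCoeff, iteratedDeriv_const_mul_field, iteratedDeriv_fun_sum fun i _ => (ha i).contDiffAt,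
    mul_left_comm, Finset.mul_sum]
  rfl

theorem coeff_cmul_sum {A ι : Type*} [Ring A] [Algebra ℂ A] [Fintype ι] (c : ℂ) (P Q : ι → A⟦X⟧)
    (m : ℕ) : PowerSeries.coeff m (cmul c (∑ i, (P i + Q i)))
      = c • ∑ i, (PowerSeries.coeff m (P i) + PowerSeries.coeff m (Q i)) := by
  simp [cmul]

/-- On linear functions, the combination of the series is the series of the combination. -/
theorem coeff_linCombSeries_apply {k : ℕ} (hU : ∀ z ∈ U, star z ∈ U) (ψ : Fin k → Integrator U)
    (L : (Fin d → ℂ) →L[ℂ] ℂ) (g : HolFun U) (hg : ∀ z ∈ U, g.1 z = L z) (m : ℕ)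
    {z : Fin d → ℂ} (hz : z ∈ U) :
    (PowerSeries.coeff m (linCombSeries hU ψ) g).1 z
      = taylorCoeff m fun h : ℂ => L (linComb hU ψ h z) := by
  set M : Fin k ⊕ Fin k → Integrator U := Sum.elim ψ fun j => (ψ j).conj hU
  have h1 : PowerSeries.coeff m (linCombSeries hU ψ)
      = (1 / (2 * k) : ℂ) • ∑ j, ((ψ j).opCoeff m + ((ψ j).conj hU).opCoeff m) := by
    refine (coeff_cmul_sum _ _ _ _).trans ?_
    refine congrArg _ (Finset.sum_congr rfl fun j _ => ?_)
    exact congrArg₂ _ ((ψ j).coeff_opSeries m) (((ψ j).conj hU).coeff_opSeries m)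
  -- g agrees with L only on U, where each M_i(h, z) lies for small h.
  have h2 : (fun h : ℂ => L (linComb hU ψ h z))
      =ᶠ[𝓝 0] fun h => (1 / (2 * k) : ℂ) * ∑ i, g.1 ((M i).toFun h z) := by
    filter_upwards [eventually_all.2 fun i => ((M i).tendsto_time hz).eventually
      (U.isOpen.mem_nhds hz)] with h hh
    have h3 : ∀ i, g.1 ((M i).toFun h z) = L ((M i).toFun h z) := fun i => hg _ (hh i)
    simp only [h3, linComb_eq_weightedSum, weightedSum, map_smul, map_sum, smul_eq_mul]
    rfl
  rw [taylorCoeff_congr h2, taylorCoeff_smul_sum _ fun i => (M i).analyticAt_time g hz,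
    Fintype.sum_sum_type, ← Finset.sum_add_distrib, h1]
  simp [M, Integrator.opCoeff_apply _ _ _ hz]

/-- Pseudo-symmetry and pseudo-symplecticity of combinations whose terms agree up to
`O(h ^ m)`. -/
theorem linComb_compList_pseudo {k : ℕ} (hk : 1 ≤ k) (hU : ∀ z ∈ U, star z ∈ U)
    {S : Integrator U} (hSsymm : IsTimeSymmetric U S.toFun) (hSreal : IsRealMethod U S.toFun)
    {l : Fin k → List ℂ} (hl : ∀ j, (l j).map star = (l j).reverse) {m q : ℕ}
    (hq : q + 1 = 2 * m)
    (hm : ∀ i i' : Fin k ⊕ Fin k,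
      EqUpTo m (compSeries S.opSeries (Sum.elim l (fun j => (l j).reverse) i))
        (compSeries S.opSeries (Sum.elim l (fun j => (l j).reverse) i'))) :
    IsPseudoSymmetric U (linComb hU fun j => S.compList (l j)) q ∧
    ∀ J : Matrix (Fin d) (Fin d) ℝ, IsSymplectic U J S.toFun →
      IsPseudoSymplectic U J (linComb hU fun j => S.compList (l j)) q := by
  have hc : (1 / (2 * k) : ℂ) * Fintype.card (Fin k ⊕ Fin k) = 1 := by
    have : (k : ℂ) ≠ 0 := Nat.cast_ne_zero.2 (by omega)
    rw [Fintype.card_sum, Fintype.card_fin]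
    push_cast
    field_simp
    ring
  set M : Fin k ⊕ Fin k → Integrator U :=
    Sum.elim (fun j => S.compList (l j)) fun j => (S.compList (l j)).conj hU
  have hser : ∀ i, (M i).opSeries
      = compSeries S.opSeries (Sum.elim l (fun j => (l j).reverse) i) := by
    rintro (j | j)
    · exact opSeries_compList S (l j)
    · exact opSeries_conj_compList hU hSreal (hl j)
  have hM : ∀ i i', EqUpTo m (M i).opSeries (M i').opSeries := fun i i' => by
    rw [hser, hser]
    exact hm i i'
  -- The telescoping identity with h replaced by -h.
  have hinv : ∀ l' : List ℂ, scaleSeries (-1) (compSeries S.opSeries l'.reverse) *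
      compSeries S.opSeries l' = 1 := fun l' => by
    have h1 := congrArg (scaleSeries (-1))
      (compSeries_reverse_mul (Integrator.opSeries_mul_scaleSeries_neg_one hSsymm) l')
    rw [scaleSeries_mul, scaleSeries_scaleSeries, scaleSeries_one] at h1
    have h2 : ∀ Q : (Op U)⟦X⟧, scaleSeries (-1 * -1) Q = Q := fun Q => by
      ext1 i
      erw [coeff_scaleSeries]
      simp
    rw [h2] at h1
    exact h1
  rw [linComb_eq_weightedSum]
  -- The adjoint of each composition is its conjugate, so the pairing swaps the two summands of the
  -- index type.
  refine ⟨isPseudoSymmetric_weightedSum hc hq hM (Equiv.sumComm _ _) ?_, fun J hJ =>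
    isPseudoSymplectic_weightedSum hc hq hM ?_⟩
  · rintro (j | j)
    · rw [hser, hser]
      exact hinv (l j)
    · rw [hser, hser]
      have := hinv (l j).reverse
      rw [List.reverse_reverse] at this
      exact this
  · rintro (j | j)
    · exact hJ.isLocallySymplectic.compList (l j)
    · exact (hJ.isLocallySymplectic.compList (l j).reverse).congr
        ((opSeries_compList S _).trans (hser (Sum.inr j)).symm)

end Main

/-! ### Agreement between different consistent compositions -/

section Agreement

variable {A : Type*} [Ring A] [Algebra ℂ A] {P : A⟦X⟧} {F : A} {N : ℕ}

theorem compSeries_eqUpTo_compSeries (hP : EqUpTo N P (expSeries 1 F)) (hN : 2 ≤ N)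
    {l l' : List ℂ} (hl : l.sum = 1) (hl' : l'.sum = 1) :
    EqUpTo N (compSeries P l) (compSeries P l') := by
  have h : ∀ l : List ℂ, l.sum = 1 → EqUpTo N (compSeries P l) (expSeries 1 F) := fun l hl => by
    refine ((compSeries_eqUpTo hP hN l).mono (Nat.le_succ N)).trans ?_
    rw [hl]
    simpa only [add_zero] using (EqUpTo.refl N (expSeries 1 F)).add (eqUpTo_monomial N _)
  exact (h l hl).trans (h l' hl').symm

/-- The h^N coefficient of a consistent composition depends on its coefficients only through the sum
of their N-th powers. -/
theorem compSeries_eqUpTo_compSeries_succ (hP : EqUpTo N P (expSeries 1 F)) (hN : 2 ≤ N)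
    {l l' : List ℂ} (hl : l.sum = 1) (hl' : l'.sum = 1)
    (h : (l.map (· ^ N)).sum = (l'.map (· ^ N)).sum) :
    EqUpTo (N + 1) (compSeries P l) (compSeries P l') := by
  have h1 := compSeries_eqUpTo hP hN l
  have h2 := compSeries_eqUpTo hP hN l'
  rw [hl, h] at h1
  rw [hl'] at h2
  exact h1.trans h2.symm

end Agreement

theorem map_star_ofFn {s : ℕ} {α : Fin s → ℂ} (hα : ∀ i, star (α (Fin.rev i)) = α i) :
    (List.ofFn α).map star = (List.ofFn α).reverse := by
  refine List.ext_getElem (by simp) fun i h1 h2 => ?_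
  have hi : i < s := by simpa using h1
  have := hα (Fin.rev ⟨i, hi⟩)
  rw [Fin.rev_rev] at this
  simp only [List.getElem_map, List.getElem_ofFn, List.getElem_reverse, List.length_ofFn, this]
  congr 1
  ext
  simp [Fin.val_rev]
  omega

theorem EqUpTo.mul_mul {A : Type*} [Ring A] [Algebra ℂ A] {m : ℕ} {P Q : A⟦X⟧} (h : EqUpTo m P Q)
    (E : A⟦X⟧) : EqUpTo m (E * P * E) (E * Q * E) :=
  ((EqUpTo.refl m E).mul h).mul (EqUpTo.refl m E)

/-- The expansions of a family of symmetric-conjugate compositions of a symmetric real method. -/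
theorem symmetricConjugate_expansions {A : Type*} [Ring A] [Algebra ℂ A] {n k : ℕ} (hn : 1 ≤ n)
    (hk : 1 ≤ k) {σ : A →+* A} (hσ : ∀ (c : ℂ) (a : A), σ (c • a) = star c • σ a)
    {P : A⟦X⟧} {F : A} (hP : EqUpTo (2 * n + 1) P (expSeries 1 F))
    (hPσ : PowerSeries.map σ P = P) (hsymm : P * scaleSeries (-1) P = 1)
    {l : Fin k → List ℂ} (hl : ∀ j, (l j).map star = (l j).reverse) (hsum : ∀ j, (l j).sum = 1)
    {Ψ Ψbar W Wbar : Fin k → A⟦X⟧} {μ : Fin k → ℂ} {E : A⟦X⟧} (hE : E = expSeries (1 / 2) F)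
    (hΨ : ∀ j, Ψ j = compSeries P (l j)) (hΨbar : ∀ j, Ψbar j = compSeries P (l j).reverse)
    (hW : ∀ j, W j = centralLog F (compSeries P (l j)))
    (hWbar : ∀ j, Wbar j = PowerSeries.map σ (W j))
    (hμ : ∀ j, μ j = ((l j).map (· ^ (2 * n + 1))).sum) :
    (∀ j, Ψ j = E * fexp (W j) * E ∧ Ψbar j = E * fexp (Wbar j) * E ∧
      EqUpTo (2 * n + 1) (W j) 0 ∧
      PowerSeries.coeff (2 * n + 1) (W j) = μ j • PowerSeries.coeff (2 * n + 1) (flog P)) ∧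
    (∀ j, ∀ m, Even m → PowerSeries.coeff m (W j + Wbar j) = 0) ∧
    (∀ j, EqUpTo (4 * n + 4) (cmul (1 / 2) (Ψ j + Ψbar j))
      (E * fexp (cmul (1 / 2) (W j + Wbar j)) * E)) ∧
    EqUpTo (4 * n + 4) (cmul (1 / (2 * k)) (∑ j, (fexp (W j) + fexp (Wbar j))))
      (fexp (cmul (1 / (2 * k)) (∑ j, (W j + Wbar j)))
        + PowerSeries.monomial (4 * n + 2)
          ((1 / (2 * k) * (∑ j, μ j ^ 2 - 1 / k * (∑ j, μ j) ^ 2) : ℂ) •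
            PowerSeries.coeff (2 * n + 1) (flog P) ^ 2)) ∧
    EqUpTo (4 * n + 2) (cmul (1 / (2 * k)) (∑ j, (Ψ j + Ψbar j)))
      (E * fexp (cmul (1 / (2 * k)) (∑ j, (W j + Wbar j))) * E) := by
  have hN : 2 ≤ 2 * n + 1 := by omega
  have hodd : Odd (2 * n + 1) := odd_two_mul_add_one n
  have hP1 : PowerSeries.constantCoeff P = 1 :=
    (hP.constantCoeff (by omega)).trans (constantCoeff_expSeries 1 F)
  have hF : σ F = F := map_eq_of_eqUpTo_expSeries hN hP hPσ
  have hneg : ∀ j, Wbar j = -scaleSeries (-1) (W j) := fun j => by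
    rw [hWbar, hW]
    exact map_centralLog hσ hF hPσ hP1 hsymm (hl j)
  have hlead : ∀ j, EqUpTo (2 * n + 1) (W j) 0 ∧ PowerSeries.coeff (2 * n + 1) (W j)
      = μ j • PowerSeries.coeff (2 * n + 1) (flog P) := fun j => by
    rw [hW, hμ]
    exact centralLog_leading hP hN (hsum j)
  have hfac : ∀ j, Ψ j = E * fexp (W j) * E := fun j => by
    rw [hΨ, hW, hE]
    exact eq_mul_fexp_centralLog_mul (constantCoeff_compSeries hP1 _) F
  -- Obtained by applying σ to the factorization of Ψ; the half step is real and hence fixed.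
  have hfacbar : ∀ j, Ψbar j = E * fexp (Wbar j) * E := fun j => by
    have h := congrArg (PowerSeries.map σ) ((hΨ j).symm.trans (hfac j))
    rw [map_compSeries hσ hPσ, hl, map_mul, map_mul, map_fexp hσ, hE, map_expSeries hσ hF] at h
    rw [hΨbar, h, hWbar, hE]
    simp
  have hmean := mean_fexp_add_fexp_eqUpTo hk hN hodd hneg (fun j => (hlead j).1)
    fun j => (hlead j).2
  rw [show 2 * (2 * n + 1) + 2 = 4 * n + 4 by ring, show 2 * (2 * n + 1) = 4 * n + 2 by ring]
    at hmean
  refine ⟨fun j => ⟨hfac j, hfacbar j, hlead j⟩,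
    fun j m hm => coeff_add_eq_zero_of_even (hneg j) hm, fun j => ?_, ?_, ?_⟩
  · rw [hfac, hfacbar, ← add_mul, ← mul_add, cmul_eq_smul, cmul_eq_smul, ← smul_mul_assoc,
      ← mul_smul_comm]
    refine EqUpTo.mul_mul ?_ E
    have := half_fexp_add_fexp_eqUpTo hN (hlead j).1
      (eqUpTo_succ_of_odd (hneg j) (hlead j).1 hodd)
    rwa [show 2 * (2 * n + 1) + 2 = 4 * n + 4 by ring] at this
  · rw [cmul_eq_smul, cmul_eq_smul]
    exact hmean
  · have h1 : ∀ j, Ψ j + Ψbar j = E * (fexp (W j) + fexp (Wbar j)) * E := fun j => by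
      rw [hfac, hfacbar, mul_add, add_mul]
    simp only [h1]
    rw [← Finset.sum_mul, ← Finset.mul_sum, cmul_eq_smul, cmul_eq_smul, ← smul_mul_assoc,
      ← mul_smul_comm]
    -- At this lower order the variance term at h^{4n+2} drops out.
    refine EqUpTo.mul_mul ((hmean.mono (by omega)).trans ?_) E
    have h2 := (EqUpTo.refl (4 * n + 2)
      (fexp ((1 / (2 * k) : ℂ) • ∑ j, (W j + Wbar j)))).add
      (eqUpTo_monomial (4 * n + 2) ((1 / (2 * k) * (∑ j, μ j ^ 2 - 1 / k * (∑ j, μ j) ^ 2) : ℂ) •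
        PowerSeries.coeff (2 * n + 1) (flog P) ^ 2))
    rwa [add_zero] at h2

end OneStep

end

open OneStep
-- Specialization to operators on holomorphic functions, and conclusion
theorem mainTheorem1 {d n k : ℕ} (hn : 1 ≤ n) (hk : 1 ≤ k)
    (U : TopologicalSpace.Opens (Fin d → ℂ)) (hU : ∀ z ∈ U, star z ∈ U)
    (f : (Fin d → ℂ) → (Fin d → ℂ)) (hf : AnalyticOnNhd ℂ f U)
    (hfreal : ∀ z ∈ U, f (star z) = star (f z))
    (S : Integrator U) (hSorder : HasOrder U f S.toFun (2 * n))
    (hSsymm : IsTimeSymmetric U S.toFun) (hSreal : IsRealMethod U S.toFun)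
    (s : Fin k → ℕ) (α : (j : Fin k) → Fin (s j) → ℂ)
    (hαsymm : ∀ j i, star (α j (Fin.rev i)) = α j i)
    (hαcons : ∀ j, ∑ i, α j i = 1) :
    let F : Op U := lieDeriv f hf
    let Y : (Op U)⟦X⟧ := flog S.opSeries
    let ψ : Fin k → Integrator U := fun j => S.composition (α j)
    let φ : ℂ → (Fin d → ℂ) → (Fin d → ℂ) := linComb hU ψ
    let Φ : (Op U)⟦X⟧ := linCombSeries hU ψ
    let W : Fin k → (Op U)⟦X⟧ := fun j => centralExponent F (ψ j)
    let Wbar : Fin k → (Op U)⟦X⟧ := fun j => conjSeries hU (W j)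
    let μ : Fin k → ℂ := fun j => ∑ i, α j i ^ (2 * n + 1)
    let E : (Op U)⟦X⟧ := expStep (1 / 2) F
    -- `Φ` acts on linear functions as the linear combination `φ` does
    (∀ (L : (Fin d → ℂ) →L[ℂ] ℂ) (g : HolFun U), (∀ z ∈ U, g.1 z = L z) →
      ∀ m, ∀ z ∈ U, (PowerSeries.coeff m Φ g).1 z
        = (m.factorial : ℂ)⁻¹ * iteratedDeriv m (fun h : ℂ => L (φ h z)) 0) ∧
    -- the factorization of each series, the size of the exponents, and their leading terms
    (∀ j, (ψ j).opSeries = E * fexp (W j) * E ∧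
      ((ψ j).conj hU).opSeries = E * fexp (Wbar j) * E ∧
      EqUpTo (2 * n + 1) (W j) 0 ∧
      PowerSeries.coeff (2 * n + 1) (W j) = μ j • PowerSeries.coeff (2 * n + 1) Y) ∧
    -- only odd powers of `h` occur in the sums with the conjugates
    (∀ j, ∀ m, Even m → PowerSeries.coeff m (W j + Wbar j) = 0) ∧
    -- each term is the series of a time-symmetric method up to `O(h ^ (4n + 4))`
    (∀ j, EqUpTo (4 * n + 4)
      (cmul (1 / 2) ((ψ j).opSeries + ((ψ j).conj hU).opSeries))
      (E * fexp (cmul (1 / 2) (W j + Wbar j)) * E)) ∧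
    -- the central factor of `Φ`, up to `O(h ^ (4n + 4))`
    EqUpTo (4 * n + 4)
      (cmul (1 / (2 * k)) (∑ j, (fexp (W j) + fexp (Wbar j))))
      (fexp (cmul (1 / (2 * k)) (∑ j, (W j + Wbar j)))
        + PowerSeries.monomial (4 * n + 2)
          ((1 / (2 * k) * (∑ j, μ j ^ 2 - 1 / k * (∑ j, μ j) ^ 2)) •
            PowerSeries.coeff (2 * n + 1) Y ^ 2)) ∧
    -- the operator series of `φ`, up to `O(h ^ (4n + 2))`
    EqUpTo (4 * n + 2) Φ (E * fexp (cmul (1 / (2 * k)) (∑ j, (W j + Wbar j))) * E) ∧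
    -- pseudo-symmetry
    (∀ j, IsPseudoSymmetric U (reMethod hU (ψ j)) (4 * n + 3)) ∧
    IsPseudoSymmetric U φ (4 * n + 1) ∧
    ((∀ i j, μ i = μ j) → IsPseudoSymmetric U φ (4 * n + 3)) ∧
    -- pseudo-symplecticity
    (∀ J : Matrix (Fin d) (Fin d) ℝ, Jᵀ = -J → IsUnit J.det →
      IsHamiltonian U J f → IsSymplectic U J S.toFun →
      (∀ j, IsPseudoSymplectic U J (reMethod hU (ψ j)) (4 * n + 3)) ∧
      IsPseudoSymplectic U J φ (4 * n + 1) ∧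
      ((∀ i j, μ i = μ j) → IsPseudoSymplectic U J φ (4 * n + 3))) := by
  intro F Y ψ φ Φ W Wbar μ E
  have hN : 2 ≤ 2 * n + 1 := by omega
  set l : Fin k → List ℂ := fun j => List.ofFn (α j)
  have hl : ∀ j, (l j).map star = (l j).reverse := fun j => map_star_ofFn (hαsymm j)
  have hsum : ∀ j, (l j).sum = 1 := fun j => by rw [List.sum_ofFn, hαcons]
  have hμ : ∀ j, μ j = ((l j).map (· ^ (2 * n + 1))).sum := fun j => by
    rw [List.map_ofFn, List.sum_ofFn]
    rfl
  have hP : EqUpTo (2 * n + 1) S.opSeries (expSeries 1 F) := opSeries_eqUpTo_expStep hf hSorder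
  have hPσ : PowerSeries.map (conjOpHom hU) S.opSeries = S.opSeries :=
    (conjSeries_eq_map hU _).symm.trans (Integrator.conjSeries_opSeries hU hSreal)
  have hΨ : ∀ j, (ψ j).opSeries = compSeries S.opSeries (l j) := fun j =>
    opSeries_compList S (l j)
  have hΨbar : ∀ j, ((ψ j).conj hU).opSeries = compSeries S.opSeries (l j).reverse := fun j =>
    opSeries_conj_compList hU hSreal (hl j)
  have hW : ∀ j, W j = centralLog F (compSeries S.opSeries (l j)) := fun j =>
    congrArg (centralLog F) (hΨ j)
  have hWbar : ∀ j, Wbar j = PowerSeries.map (conjOpHom hU) (W j) := fun j =>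
    conjSeries_eq_map hU (W j)
  obtain ⟨h1, h2, h3, h4, h5⟩ := symmetricConjugate_expansions (A := Op U) hn hk
    (σ := conjOpHom hU) (conjOpHom_smul hU) hP hPσ
    (Integrator.opSeries_mul_scaleSeries_neg_one hSsymm) hl hsum (E := E) rfl hΨ hΨbar hW hWbar hμ
  have hsumL : ∀ i : Fin k ⊕ Fin k, (Sum.elim l (fun j => (l j).reverse) i).sum = 1 := by
    rintro (j | j)
    · exact hsum j
    · exact (List.sum_reverse _).trans (hsum j)
  have hpow : ∀ j, ((l j).reverse.map (· ^ (2 * n + 1))).sum = μ j := fun j => by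
    rw [List.map_reverse, List.sum_reverse, hμ]
  -- Consistency alone gives agreement up to O(h^{2n+1}), and doubling yields 4n + 2.
  have hall := linComb_compList_pseudo hk hU hSsymm hSreal hl
    (show 4 * n + 1 + 1 = 2 * (2 * n + 1) by ring)
    fun i i' => compSeries_eqUpTo_compSeries hP hN (hsumL i) (hsumL i')
  -- Equal μ_j also match the coefficients of h^{2n+1}, so the terms agree up to O(h^{2n+2}), and
  -- doubling yields 4n + 4.
  have heq := fun hμμ : ∀ i j, μ i = μ j => linComb_compList_pseudo hk hU hSsymm hSreal hl
    (show 4 * n + 3 + 1 = 2 * (2 * n + 1 + 1) by ring)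
    fun i i' => compSeries_eqUpTo_compSeries_succ hP hN (hsumL i) (hsumL i') (by
      rcases i with i | i <;> rcases i' with i' | i' <;>
        simp only [Sum.elim_inl, Sum.elim_inr, hpow, ← hμ] <;> exact hμμ i i')
  -- For a single pair the condition on μ is automatic: reversal permutes the coefficients.
  have hre : ∀ j, IsPseudoSymmetric U (reMethod hU (ψ j)) (4 * n + 3) ∧
      ∀ J : Matrix (Fin d) (Fin d) ℝ, IsSymplectic U J S.toFun →
        IsPseudoSymplectic U J (reMethod hU (ψ j)) (4 * n + 3) := fun j => by
    rw [reMethod_eq_linComb]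
    refine linComb_compList_pseudo le_rfl hU hSsymm hSreal (l := fun _ : Fin 1 => l j)
      (fun _ => hl j) (show 4 * n + 3 + 1 = 2 * (2 * n + 1 + 1) by ring) fun i i' => ?_
    refine compSeries_eqUpTo_compSeries_succ hP hN ?_ ?_ ?_
    · rcases i with i | i
      · exact hsum j
      · exact (List.sum_reverse _).trans (hsum j)
    · rcases i' with i' | i'
      · exact hsum j
      · exact (List.sum_reverse _).trans (hsum j)
    · rcases i with i | i <;> rcases i' with i' | i' <;>
        simp only [Sum.elim_inl, Sum.elim_inr, hpow, ← hμ]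
  exact ⟨fun L g hg m z hz => coeff_linCombSeries_apply hU ψ L g hg m hz, h1, h2, h3, h4, h5,
    fun j => (hre j).1, hall.1, fun hμμ => (heq hμμ).1, fun J _ _ _ hJ =>
      ⟨fun j => (hre j).2 J hJ, hall.2 J hJ, fun hμμ => (heq hμμ).2 J hJ⟩⟩
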